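/- Setting. Let $A=(a_{i,j})_{i,j\in I}$ be a Kac–Moody matrix ($I$ finite, $a_{i,i}=2$, $a_{i,j}\le 0$ for $i\ne j$, $a_{i,j}=0\Leftrightarrow a_{j,i}=0$), $Y$ a free $\mathbb Z$-module of finite rank, $(\alpha_i)$ a free family in $\mathrm{Hom}(Y,\mathbb Z)$ and $(\alpha_i^\vee)$ a free family in $Y$ with $\alpha_j(\alpha_i^\vee)=a_{i,j}$. Let $W^v$ be the group generated by the reflections $r_i(x)=x-\alpha_i(x)\alpha_i^\vee$, with length $\ell$; let $Y^+=\{x\in Y: \exists w\in W^v\ \forall i,\ \alpha_i(w x)\ge 0\}$ (the intersection of $Y$ with the Tits cone), and write $x\le_{Q^\vee}y$ if $y-x\in\bigoplus_i\mathbb N\alpha_i^\vee$. Let $\mathcal R$ be a commutative ring and let $\sigma_i,\sigma_i'\in\mathcal R^\times$ satisfy $\sigma_i=\sigma_i'$ if $\alpha_i(Y)=\mathbb Z$, and $\sigma_i=\sigma_j=\sigma_i'=\sigma_j'$ if $\alpha_i(\alpha_j^\vee)=\alpha_j(\alpha_i^\vee)=-1$. Let ${}^{BL}\mathcal H$ be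 the free $\mathcal R$-module with basis $(Z^\lambda H_w)_{\lambda\in Y,w\in W^v}$, with its unique associative product such that $Z^\lambda*H_w=Z^\lambda H_w$, $Z^\lambda*Z^\mu=Z^{\lambda+\mu}$, $H_{r_i}*H_w=H_{r_iw}$ if $\ell(r_iw)=\ell(w)+1$ and $H_{r_i}*H_w=(\sigma_i-\sigma_i^{-1})H_w+H_{r_iw}$ otherwise, and $H_{r_i}*Z^\lambda-Z^{r_i\lambda}*H_{r_i}=\frac{(\sigma_i-\sigma_i^{-1})+(\sigma_i'-\sigma_i'^{-1})Z^{-\alpha_i^\vee}}{1-Z^{-2\alpha_i^\vee}}(Z^\lambda-Z^{r_i\lambda})$. The Iwahori–Hecke algebra $\mathcal H$ is the span of the $Z^\lambda H_w$ with $\lambda\in Y^+$. A set $E\subseteq Y$ is almost finite if there is a finite $J\subseteq Y$ such that every $\lambda\in E$ satisfies $\lambda\le_{Q^\vee}\nu$ for some $\nu\in J$. The Looijenga algebra $\mathcal R[[Y]]$ is the set of formal series $\sum_{\lambda\in Y} a_\lambda e^\lambda$ with almost finite support, with $e^\lambda e^\mu=e^{\lambda+\mu}$, and $\mathcal R[[Y]]^{W^v}$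 consists of the series with $a_{w\lambda}=a_\lambda$ for all $w\in W^v$. Let $\hat{\mathcal H}$ be the set of formal sums $\sum_{(\lambda,w)\in Y^+\times W^v}a_{\lambda,w}Z^\lambda H_w$ with $\{w:\exists\lambda,\ a_{\lambda,w}\neq0\}$ finite and $\{\lambda: a_{\lambda,w}\ne0\}$ almost finite for each $w$. The convolution $a*b$ is defined if, for each $(\mu,v)$, only finitely many of the coefficients of $Z^\mu H_v$ in the $a_{\lambda,w}b_{\lambda',w'}\,Z^\lambda H_w*Z^{\lambda'}H_{w'}$ are non-zero; $a*b$ is then their sum. For a set $V$ of formal sums, let $\mathcal Z(V)$ be the set of $z\in V$ such that for all $a\in V$ the convolutions $z*a$ and $a*z$ are defined and equal. Let $\hat{\mathcal H}^b$ be the set of $a\in\hat{\mathcal H}$ for which there is a finite $J\subseteq Y$ such that whenever $a_{\lambda,w}\ne0$, some $\nu\in J$ satisfies $v\lambda\le_{Q^\vee}\nu$ for all $v\in W^v$. Identify $\sum a_\lambda e^\lambda$ with $\sum a_\lambda Z^\lambda$. Let $\mathbb A=Y\otimes\mathbb R$. An indecomposable component $B$ of $A$ is of finite type if $\det B\neq0$,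 there is $u>0$ with $Bu>0$, and $Bv\ge0$ implies $v>0$ or $v=0$. A decomposition of $\mathbb A$ is a direct sum $\mathbb A=\bigoplus_j\mathbb A_j$ over the indecomposable components $A_j$, indexed by $I_j\subseteq I$, such that $\alpha_i^\vee\in\mathbb A_j$ for $i\in I_j$ and $\alpha_i|_{\mathbb A_j}=0$ for $i\notin I_j$. Put $\mathbb A^f=\bigoplus_{A_j\text{ finite type}}\mathbb A_j$, $\mathbb A^\infty_{in}=\bigoplus_{A_j\text{ not finite type}}(\mathbb A_j\cap\bigcap_{i\in I_j}\ker\alpha_i)$, $Y^f=Y\cap\mathbb A^f$ and $Y^\infty_{in}=Y\cap\mathbb A^\infty_{in}$. Theorem. (1) $\mathcal Z(\hat{\mathcal H})=\mathcal R[[Y]]^{W^v}$. Moreover, any two elements of $\hat{\mathcal H}^b$ have a convolution, which lies in $\hat{\mathcal H}^b$, and $\mathcal Z(\hat{\mathcal H}^b)=\mathcal R[[Y]]^{W^v}$. The set $\mathcal R[[Y]]^{W^v}$ is closed under the product of $\mathcal R[[Y]]$, and on it this product is the convolution. (2) The center $\mathcal Z(\mathcal H)$ of $\mathcal H$ is $\mathcal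 R[L]^{W^v}$, where $L$ is the set of $\lambda\in Y$ such that $\alpha_i(\lambda)=0$ for all $i$ in components that are not of finite type. For every decomposition $\mathbb A=\bigoplus_j\mathbb A_j$, the sum $\mathbb A^f+\mathbb A^\infty_{in}$ is direct and $\mathcal Z(\mathcal H)=\mathcal R[Y\cap(\mathbb A^f\oplus\mathbb A^\infty_{in})]^{W^v}$; if moreover $Y=\bigoplus_j (Y\cap\mathbb A_j)$, then $\mathcal Z(\mathcal H)=\mathcal R[Y^f\oplus Y^\infty_{in}]^{W^v}$. In particular, if no component of $A$ is of finite type, then $\mathcal Z(\mathcal H)=\mathcal R[Y_{in}]$ with $Y_{in}=\{\lambda\in Y:\alpha_i(\lambda)=0\ \forall i\in I\}$. -/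

import Mathlib

open scoped TensorProduct

noncomputable section

/-- A root generating system `(A, X, Y, (α_i), (α_i^∨))` with finite index set `I`. The lattice `X` is
the `ℤ`-dual of the free `ℤ`-module `Y` of finite rank (the freeness and finiteness of `Y` are
instance arguments of the theorem). -/
structure RootGeneratingSystem (I Y : Type*) [AddCommGroup Y] where
  /-- the Kac-Moody matrix -/
  A : Matrix I I ℤ
  A_diag : ∀ i, A i i = 2
  A_offdiag : ∀ i j, i ≠ j → A i j ≤ 0
  A_zero : ∀ i j, A i j = 0 ↔ A j i = 0
  /-- the simple roots -/
  root : I → Module.Dual ℤ Y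
  /-- the simple coroots -/
  coroot : I → Y
  pairing : ∀ i j, A i j = root j (coroot i)
  root_free : LinearIndependent ℤ root
  coroot_free : LinearIndependent ℤ coroot

namespace RootGeneratingSystem

variable {I Y R : Type*} [AddCommGroup Y] [CommRing R] (S : RootGeneratingSystem I Y)

/-! ### The Weyl group -/

theorem root_coroot_self (i : I) : S.root i (S.coroot i) = 2 := by
  rw [← S.pairing, S.A_diag]

/-- The simple reflection `r_i(v) = v - α_i(v) α_i^∨`, as an automorphism of `Y`. -/
def refl (i : I) : Y ≃ₗ[ℤ] Y := Module.reflection (S.root_coroot_self i)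

/-- The Weyl group `W^v`. It is generated by the `r_i`, preserves `Y`, and acts faithfully on it. -/
def W : Subgroup (Y ≃ₗ[ℤ] Y) := Subgroup.closure (Set.range S.refl)

/-- The simple reflection `r_i` as an element of `W^v`. -/
def s (i : I) : S.W := ⟨S.refl i, Subgroup.subset_closure ⟨i, rfl⟩⟩

/-- The element `r_{i_1} ⋯ r_{i_k}` of `W^v`. -/
def wordProd (l : List I) : S.W := (l.map S.s).prod

theorem s_mul_self (i : I) : S.s i * S.s i = 1 := by
  apply Subtype.ext
  apply LinearEquiv.ext
  intro x
  exact Module.involutive_reflection (S.root_coroot_self i) x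

theorem exists_word (w : S.W) : ∃ l : List I, S.wordProd l = w := by
  obtain ⟨w, hw⟩ := w
  induction hw using Subgroup.closure_induction with
  | mem x hx =>
    obtain ⟨i, rfl⟩ := hx
    exact ⟨[i], by simp [wordProd, s]⟩
  | one => exact ⟨[], rfl⟩
  | mul x y hx hy ihx ihy =>
    obtain ⟨l, hl⟩ := ihx
    obtain ⟨l', hl'⟩ := ihy
    refine ⟨l ++ l', ?_⟩
    have h : S.wordProd (l ++ l') = S.wordProd l * S.wordProd l' := by simp [wordProd]
    rw [h, hl, hl']
    rfl
  | inv x hx ihx =>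
    obtain ⟨l, hl⟩ := ihx
    refine ⟨l.reverse, ?_⟩
    have h : ∀ l : List I, S.wordProd l.reverse = (S.wordProd l)⁻¹ := by
      intro l
      induction l with
      | nil => simp [wordProd]
      | cons i l ih =>
        have hi : (S.s i)⁻¹ = S.s i := inv_eq_of_mul_eq_one_left (S.s_mul_self i)
        simp only [wordProd, List.reverse_cons, List.map_append, List.prod_append, List.map_cons,
          List.prod_cons, List.map_nil, List.prod_nil, mul_one, mul_inv_rev] at ih ⊢
        rw [ih, hi]
    rw [h, hl]
    rfl

/-- The length `l(w)` with respect to the simple reflections. -/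
def length (w : S.W) : ℕ := sInf {n | ∃ l : List I, l.length = n ∧ S.wordProd l = w}

theorem exists_reduced (w : S.W) : ∃ l : List I, l.length = S.length w ∧ S.wordProd l = w :=
  Nat.sInf_mem (s := {n | ∃ l : List I, l.length = n ∧ S.wordProd l = w})
    (let ⟨l, hl⟩ := S.exists_word w; ⟨l.length, l, rfl, hl⟩)

/-- A reduced word of `w`. -/
def reducedWord (w : S.W) : List I := (S.exists_reduced w).choose

/-- `Y⁺`, the intersection of `Y` with the Tits cone `⋃ w . closure(C_f)`. -/
def Yplus : Set Y := {x | ∃ w : S.W, ∀ i, 0 ≤ S.root i ((w : Y ≃ₗ[ℤ] Y) x)}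

/-- The order `x ≤_{Q^∨} y`, that is, `y - x ∈ ⨁ ℕ α_i^∨`. -/
def leQ [Fintype I] (x y : Y) : Prop := ∃ n : I → ℕ, y - x = ∑ i, n i • S.coroot i

/-! ### The Bernstein-Lusztig-Hecke algebra -/

/-- The free `R`-module `^{BL}H` with basis `Z^λ H_w`, for `λ ∈ Y` and `w ∈ W^v`. -/
abbrev BL (R : Type*) [CommRing R] : Type _ := (Y × S.W) →₀ R

/-- The basis element `Z^λ H_w`. -/
def ZH (R : Type*) [CommRing R] (x : Y) (w : S.W) : S.BL R := Finsupp.single (x, w) 1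

/-- Admissible parameters: invertible `σ_i`, `σ'_i` in `R` such that `σ_i = σ'_i` if `α_i(Y) = ℤ`, and
`σ_i = σ_j = σ'_i = σ'_j` if `α_i(α_j^∨) = α_j(α_i^∨) = -1`. -/
structure Parameters (R : Type*) [CommRing R] where
  /-- the parameters `σ_i` -/
  σ : I → Rˣ
  /-- the parameters `σ'_i` -/
  σ' : I → Rˣ
  eq_of_surjective : ∀ i, Function.Surjective (S.root i) → σ i = σ' i
  eq_of_conj : ∀ i j, S.root i (S.coroot j) = -1 → S.root j (S.coroot i) = -1 →
    σ i = σ j ∧ σ i = σ' i ∧ σ i = σ' j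

variable {S} (P : S.Parameters R)

/-- `σ_i - σ_i⁻¹`. -/
def Parameters.t (i : I) : R := (P.σ i : R) - ((P.σ i)⁻¹ : Rˣ)

/-- `σ'_i - σ'_i⁻¹`. -/
def Parameters.t' (i : I) : R := (P.σ' i : R) - ((P.σ' i)⁻¹ : Rˣ)

/-- The value of `H_i * H_w` prescribed by (BL2), multiplied on the left by `Z^x`. -/
def bl2 (i : I) (x : Y) (w : S.W) : S.BL R :=
  if S.length (S.s i * w) = S.length w + 1 then S.ZH R x (S.s i * w)
  else P.t i • S.ZH R x w + S.ZH R x (S.s i * w)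

/-- For `x ∈ Y` and `n` a natural number, `∑_{h < n} c_h Z^{x - h α_i^∨} H_w`, where `c_h` is
`σ_i - σ_i⁻¹` for even `h` and `σ'_i - σ'_i⁻¹` for odd `h`. -/
def blSum (i : I) (x : Y) (n : ℕ) (w : S.W) : S.BL R :=
  ∑ h ∈ Finset.range n, (if Even h then P.t i else P.t' i) • S.ZH R (x - h • S.coroot i) w

/-- The element `b(σ_i, σ'_i; Z^{-α_i^∨}) (Z^x - Z^{r_i(x)}) H_w` of (BL4), with
`b(t, u; z) = ((t - t⁻¹) + (u - u⁻¹) z) / (1 - z²)`, where the division has been carried out. -/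
def bl4 (i : I) (x : Y) (w : S.W) : S.BL R :=
  if 0 ≤ S.root i x then blSum P i x (S.root i x).toNat w
  else - blSum P i (S.refl i x) (-S.root i x).toNat w

/-- Left multiplication by `H_i`:
`H_i * Z^x H_w = Z^{r_i(x)} (H_i * H_w) + b(σ_i, σ'_i; Z^{-α_i^∨}) (Z^x - Z^{r_i(x)}) H_w`. -/
def leftH (i : I) : S.BL R →ₗ[R] S.BL R :=
  Finsupp.linearCombination R fun p : Y × S.W => bl2 P i (S.refl i p.1) p.2 + bl4 P i p.1 p.2

variable (S) in
/-- Left multiplication by `Z^x`. -/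
def leftZ (R : Type*) [CommRing R] (x : Y) : S.BL R →ₗ[R] S.BL R :=
  Finsupp.lmapDomain R R fun p : Y × S.W => (x + p.1, p.2)

/-- Left multiplication by `H_{i_1} * ⋯ * H_{i_k}`. -/
def leftWord (l : List I) : S.BL R →ₗ[R] S.BL R := (l.map (leftH P)).prod

/-- The product of `^{BL}H`: left multiplication by `Z^x H_w` is left multiplication by
`Z^x * H_{i_1} * ⋯ * H_{i_k}` for a reduced word `w = r_{i_1} ⋯ r_{i_k}`. By `IsBLProduct.eq_blMul`
below, this is the only possible associative product that satisfies (BL1) to (BL4). -/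
def blMul : S.BL R →ₗ[R] S.BL R →ₗ[R] S.BL R :=
  Finsupp.linearCombination R fun p : Y × S.W =>
    S.leftZ R p.1 ∘ₗ leftWord P (S.reducedWord p.2)

/-- An associative bilinear product on `^{BL}H` that satisfies the Bernstein-Lusztig relations. The
relation (BL4) is multiplied by the denominator `1 - Z^{-2 α_i^∨}` of `b`. -/
structure IsBLProduct (m : S.BL R →ₗ[R] S.BL R →ₗ[R] S.BL R) : Prop where
  assoc : ∀ a b c, m (m a b) c = m a (m b c)
  rel1 : ∀ x w, m (S.ZH R x 1) (S.ZH R 0 w) = S.ZH R x w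
  rel2_up : ∀ i w, S.length (S.s i * w) = S.length w + 1 →
    m (S.ZH R 0 (S.s i)) (S.ZH R 0 w) = S.ZH R 0 (S.s i * w)
  rel2_down : ∀ i w, S.length (S.s i * w) + 1 = S.length w →
    m (S.ZH R 0 (S.s i)) (S.ZH R 0 w) = P.t i • S.ZH R 0 w + S.ZH R 0 (S.s i * w)
  rel3 : ∀ x y, m (S.ZH R x 1) (S.ZH R y 1) = S.ZH R (x + y) 1
  rel4 : ∀ i x,
    m (S.ZH R 0 1 - S.ZH R (-(2 • S.coroot i)) 1)
      (m (S.ZH R 0 (S.s i)) (S.ZH R x 1) - m (S.ZH R (S.refl i x) 1) (S.ZH R 0 (S.s i))) =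
    m (P.t i • S.ZH R 0 1 + P.t' i • S.ZH R (-S.coroot i) 1)
      (S.ZH R x 1 - S.ZH R (S.refl i x) 1)

/-! ### Uniqueness of the product -/

section Uniqueness

theorem length_le (l : List I) : S.length (S.wordProd l) ≤ l.length :=
  Nat.sInf_le ⟨l, rfl, rfl⟩

theorem wordProd_cons (i : I) (l : List I) : S.wordProd (i :: l) = S.s i * S.wordProd l := by
  simp [wordProd]

theorem length_s_mul_le (i : I) (w : S.W) : S.length (S.s i * w) ≤ S.length w + 1 := by
  obtain ⟨l, hl, rfl⟩ := S.exists_reduced w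
  rw [← hl, ← wordProd_cons]
  exact length_le (i :: l)

theorem det_wordProd [Module.Free ℤ Y] [Module.Finite ℤ Y] (l : List I) :
    LinearMap.det ((S.wordProd l : Y ≃ₗ[ℤ] Y) : Y →ₗ[ℤ] Y) = (-1) ^ l.length := by
  induction l with
  | nil =>
    have h : ((S.wordProd [] : Y ≃ₗ[ℤ] Y) : Y →ₗ[ℤ] Y) = LinearMap.id := rfl
    simp [h]
  | cons i l ih =>
    have h : ((S.wordProd (i :: l) : Y ≃ₗ[ℤ] Y) : Y →ₗ[ℤ] Y) =
        (LinearMap.transvection (-S.root i) (S.coroot i)) ∘ₗ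
          ((S.wordProd l : Y ≃ₗ[ℤ] Y) : Y →ₗ[ℤ] Y) := by
      rw [wordProd_cons]
      ext x
      simp [s, refl, Module.reflection_apply, LinearMap.transvection.apply, sub_eq_add_neg]
    rw [h, LinearMap.det_comp, ih, LinearMap.transvection.det, List.length_cons, pow_succ,
      LinearMap.neg_apply, S.root_coroot_self]
    ring

theorem length_s_mul [Module.Free ℤ Y] [Module.Finite ℤ Y] (i : I) (w : S.W) :
    S.length (S.s i * w) = S.length w + 1 ∨ S.length (S.s i * w) + 1 = S.length w := by
  have h1 := length_s_mul_le i w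
  have h2 := length_s_mul_le i (S.s i * w)
  rw [← mul_assoc, S.s_mul_self, one_mul] at h2
  have h3 : S.length (S.s i * w) ≠ S.length w := by
    intro h
    obtain ⟨l, hl, hw⟩ := S.exists_reduced w
    obtain ⟨l', hl', hw'⟩ := S.exists_reduced (S.s i * w)
    have e1 := det_wordProd (S := S) (i :: l)
    have e2 := det_wordProd (S := S) l'
    rw [wordProd_cons, hw, ← hw', e2, List.length_cons, hl', h, hl, pow_succ] at e1
    rcases neg_one_pow_eq_or ℤ (S.length w) with h0 | h0 <;> rw [h0] at e1 <;> norm_num at e1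
  omega

theorem leftZ_ZH (x y : Y) (w : S.W) : S.leftZ R x (S.ZH R y w) = S.ZH R (x + y) w := by
  simp [leftZ, ZH, Finsupp.mapDomain_single]

theorem BL_ext {f g : S.BL R →ₗ[R] S.BL R} (h : ∀ x w, f (S.ZH R x w) = g (S.ZH R x w)) : f = g :=
  Finsupp.lhom_ext' fun p => LinearMap.ext_ring (h p.1 p.2)

theorem leftZ_apply (x : Y) (a : S.BL R) (p : Y × S.W) : S.leftZ R x a p = a (p.1 - x, p.2) := by
  have h : Function.Injective fun p : Y × S.W => (x + p.1, p.2) := by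
    intro p q hpq
    simp only [Prod.mk.injEq, add_right_inj] at hpq
    exact Prod.ext hpq.1 hpq.2
  have hp : p = (fun p : Y × S.W => (x + p.1, p.2)) (p.1 - x, p.2) := by simp
  conv_lhs => rw [hp]
  exact Finsupp.mapDomain_apply h _ _

/-- `1 - Z^{-2 α_i^∨}` is not a left zero divisor. -/
theorem eq_zero_of_leftZ_eq [Module.Free ℤ Y] {y : Y} (hy : y ≠ 0) {a : S.BL R}
    (h : S.leftZ R y a = a) : a = 0 := by
  by_contra ha
  obtain ⟨p, hp⟩ := Finsupp.ne_iff.1 ha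
  have key : ∀ n : ℕ, a (p.1 - n • y, p.2) = a p := by
    intro n
    induction n with
    | zero => simp
    | succ n ih =>
      rw [← ih]
      conv_rhs => rw [← h, leftZ_apply]
      rw [succ_nsmul, sub_add_eq_sub_sub]
  have hinj : Function.Injective fun n : ℕ => (p.1 - n • y, p.2) := by
    intro m n hmn
    simp only [Prod.mk.injEq, sub_right_inj, and_true] at hmn
    have h1 : ((m : ℤ) - n) • y = 0 := by
      rw [sub_smul, natCast_zsmul, natCast_zsmul, hmn, sub_self]
    rcases smul_eq_zero.1 h1 with h2 | h2
    · omega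
    · exact absurd h2 hy
  exact Set.infinite_range_of_injective hinj (a.support.finite_toSet.subset (by
    rintro _ ⟨n, rfl⟩
    have hk := key n
    simp only [Finset.mem_coe, Finsupp.mem_support_iff]
    rw [hk]
    exact hp))

theorem blSum_succ (i : I) (x : Y) (n : ℕ) (w : S.W) : blSum P i x (n + 1) w =
    blSum P i x n w + (if Even n then P.t i else P.t' i) • S.ZH R (x - n • S.coroot i) w := by
  rw [blSum, Finset.sum_range_succ, blSum]

/-- `(1 - z²) ∑_{h < n} c_h z^h = (c_0 + c_1 z) (1 - z^n)` if `n` is even or `c_0 = c_1`. -/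
theorem blSum_telescope (i : I) (n : ℕ) (hn : Even n ∨ P.t i = P.t' i) (x : Y) (w : S.W) :
    blSum P i x n w - S.leftZ R (-(2 • S.coroot i)) (blSum P i x n w) =
      P.t i • S.ZH R x w + P.t' i • S.ZH R (-S.coroot i + x) w
      - (P.t i • S.ZH R (x - n • S.coroot i) w
        + P.t' i • S.ZH R (-S.coroot i + (x - n • S.coroot i)) w) := by
  have gen : ∀ n : ℕ, blSum P i x n w - S.leftZ R (-(2 • S.coroot i)) (blSum P i x n w) =
      P.t i • S.ZH R x w + P.t' i • S.ZH R (-S.coroot i + x) w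
      - ((if Even n then P.t i else P.t' i) • S.ZH R (x - n • S.coroot i) w
        + (if Even n then P.t' i else P.t i) • S.ZH R (-S.coroot i + (x - n • S.coroot i)) w) := by
    intro n
    induction n with
    | zero => simp [blSum]
    | succ n ih =>
      have e1 : -(2 • S.coroot i) + (x - n • S.coroot i) =
          -S.coroot i + (x - (n + 1) • S.coroot i) := by
        rw [two_nsmul, succ_nsmul]; abel
      have e2 : -S.coroot i + (x - n • S.coroot i) = x - (n + 1) • S.coroot i := by
        rw [succ_nsmul]; abel
      rw [blSum_succ, map_add, map_smul, leftZ_ZH, e1, add_sub_add_comm, ih, e2]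
      by_cases hn : Even n
      · simp only [hn, if_true, Nat.even_add_one, not_true_eq_false, if_false]; abel
      · simp only [hn, if_false, Nat.even_add_one, not_false_eq_true, if_true]; abel
  rw [gen]
  rcases hn with hn | hn
  · simp only [hn, if_true]
  · simp only [hn, ite_self]

theorem even_or_t_eq (i : I) (x : Y) : Even (S.root i x) ∨ P.t i = P.t' i := by
  rcases Int.even_or_odd (S.root i x) with h | ⟨k, hk⟩
  · exact Or.inl h
  · right
    have : P.σ i = P.σ' i := by
      refine P.eq_of_surjective i fun n => ⟨n • (x - k • S.coroot i), ?_⟩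
      simp only [map_smul, map_sub, S.root_coroot_self, hk, smul_eq_mul]
      ring
    rw [Parameters.t, Parameters.t', this]

/-- The defining property of `bl4`:
`(1 - z²) bl4 = ((σ_i - σ_i⁻¹) + (σ'_i - σ'_i⁻¹) z) (Z^x - Z^{r_i(x)}) H_w` for `z = Z^{-α_i^∨}`. -/
theorem bl4_spec (i : I) (x : Y) (w : S.W) :
    bl4 P i x w - S.leftZ R (-(2 • S.coroot i)) (bl4 P i x w) =
      P.t i • S.ZH R x w + P.t' i • S.ZH R (-S.coroot i + x) w
      - (P.t i • S.ZH R (S.refl i x) w + P.t' i • S.ZH R (-S.coroot i + S.refl i x) w) := by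
  have hr : S.refl i x = x - S.root i x • S.coroot i := Module.reflection_apply _ _
  have hev := even_or_t_eq P i x
  by_cases h : 0 ≤ S.root i x
  · obtain ⟨n, hn⟩ := Int.eq_ofNat_of_zero_le h
    have hs : x - n • S.coroot i = S.refl i x := by rw [hr, hn, natCast_zsmul]
    rw [hn, Int.even_coe_nat] at hev
    have := blSum_telescope P i n hev x w
    rw [hs] at this
    simpa [bl4, h, hn] using this
  · obtain ⟨n, hn⟩ := Int.eq_ofNat_of_zero_le (show 0 ≤ -S.root i x by omega)
    have hs : S.refl i x - n • S.coroot i = x := by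
      rw [hr, ← natCast_zsmul, ← hn, neg_smul]; abel
    rw [← even_neg, hn, Int.even_coe_nat] at hev
    have := blSum_telescope P i n hev (S.refl i x) w
    rw [hs] at this
    simp only [bl4, h, if_false, hn, Int.toNat_natCast, map_neg, neg_sub_neg]
    rw [← neg_sub, this]
    abel

theorem leftZ_zero : S.leftZ R 0 = LinearMap.id := BL_ext fun x w => by simp [leftZ_ZH]

theorem bl4_eq (i : I) (x : Y) (w : S.W) (f : S.BL R →ₗ[R] S.BL R)
    (hf : ∀ y, f (S.ZH R y 1) = S.ZH R y w) : f (bl4 P i x 1) = bl4 P i x w := by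
  simp only [bl4, blSum]
  split_ifs <;> simp only [map_neg, map_sum, map_smul, hf]

/-- The product `blMul` is the only associative product that satisfies (BL1) to (BL4). -/
theorem IsBLProduct.eq_blMul [Module.Free ℤ Y] [Module.Finite ℤ Y]
    {m : S.BL R →ₗ[R] S.BL R →ₗ[R] S.BL R} (hm : IsBLProduct P m) : m = blMul P := by
  have hZ : ∀ x, m (S.ZH R x 1) = S.leftZ R x := fun x => BL_ext fun y w => by
    rw [← hm.rel1 y w, ← hm.assoc, hm.rel3, hm.rel1, hm.rel1, leftZ_ZH]
  have hZH : ∀ x w, m (S.ZH R x w) = S.leftZ R x ∘ₗ m (S.ZH R 0 w) := fun x w =>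
    LinearMap.ext fun a => by
      rw [LinearMap.comp_apply, ← hZ, ← hm.assoc, hm.rel1]
  have hHZ : ∀ i x, m (S.ZH R 0 (S.s i)) (S.ZH R x 1) =
      S.ZH R (S.refl i x) (S.s i) + bl4 P i x 1 := by
    intro i x
    have h1 := hm.rel4 i x
    rw [hm.rel1] at h1
    have hD : ∀ X, m (S.ZH R 0 1 - S.ZH R (-(2 • S.coroot i)) 1) X =
        X - S.leftZ R (-(2 • S.coroot i)) X := by
      intro X
      rw [map_sub, LinearMap.sub_apply, hZ, hZ, leftZ_zero]
      rfl
    rw [hD, map_add, map_smul, map_smul] at h1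
    simp only [hZ, LinearMap.add_apply, LinearMap.smul_apply, leftZ_zero,
      LinearMap.id_apply, map_sub (S.leftZ R (-S.coroot i)), leftZ_ZH, smul_sub] at h1
    have h2 := bl4_spec P i x 1
    have hne : -(2 • S.coroot i) ≠ 0 := by
      intro h
      rw [neg_eq_zero] at h
      have h3 := congrArg (S.root i) h
      rw [map_nsmul, S.root_coroot_self, map_zero] at h3
      norm_num at h3
    have h3 := eq_zero_of_leftZ_eq hne (a := m (S.ZH R 0 (S.s i)) (S.ZH R x 1) -
      S.ZH R (S.refl i x) (S.s i) - bl4 P i x 1) (by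
        rw [map_sub (S.leftZ R _) _ (bl4 P i x 1)]
        have h4 := h1.trans (by abel) |>.trans h2.symm
        rw [sub_eq_sub_iff_add_eq_add] at h4 ⊢
        rw [add_comm, ← h4, add_comm])
    rw [sub_sub, sub_eq_zero] at h3
    exact h3
  have hH : ∀ i, m (S.ZH R 0 (S.s i)) = leftH P i := fun i => BL_ext fun x w => by
    have e : m (S.ZH R 0 (S.s i)) (S.ZH R x w) =
        m (m (S.ZH R 0 (S.s i)) (S.ZH R x 1)) (S.ZH R 0 w) := by
      rw [hm.assoc, hm.rel1]
    have e4 : m (bl4 P i x 1) (S.ZH R 0 w) = bl4 P i x w :=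
      bl4_eq P i x w (m.flip (S.ZH R 0 w)) fun y => hm.rel1 y w
    rw [e, hHZ, map_add, LinearMap.add_apply, e4, hZH, LinearMap.comp_apply]
    have e2 : leftH P i (S.ZH R x w) = bl2 P i (S.refl i x) w + bl4 P i x w := by
      simp [leftH, ZH]
    rw [e2]
    congr 1
    rcases length_s_mul i w with h | h
    · rw [hm.rel2_up i w h, leftZ_ZH, add_zero, bl2, if_pos h]
    · rw [hm.rel2_down i w h, map_add, map_smul, leftZ_ZH, leftZ_ZH, add_zero, bl2,
        if_neg (by omega)]
  have hw : ∀ l : List I, l.length = S.length (S.wordProd l) →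
      m (S.ZH R 0 (S.wordProd l)) = leftWord P l := by
    intro l
    induction l with
    | nil =>
      intro _
      have : S.wordProd [] = 1 := rfl
      rw [this, hZ, leftZ_zero]
      rfl
    | cons i l ih =>
      intro hl
      rw [wordProd_cons, List.length_cons] at hl
      have h1 := length_s_mul_le i (S.wordProd l)
      have h2 := length_le (S := S) l
      have h3 : l.length = S.length (S.wordProd l) := by omega
      rw [wordProd_cons, ← hm.rel2_up i _ (by omega)]
      refine LinearMap.ext fun a => ?_
      rw [hm.assoc, ih h3, hH]
      simp [leftWord]
  refine Finsupp.lhom_ext' fun p => LinearMap.ext_ring ?_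
  have hp := (S.exists_reduced p.2).choose_spec
  have e := hw (S.reducedWord p.2) (by rw [reducedWord, hp.2]; exact hp.1)
  have e' : S.wordProd (S.reducedWord p.2) = p.2 := hp.2
  rw [e'] at e
  have e1 : m (S.ZH R p.1 p.2) = S.leftZ R p.1 ∘ₗ leftWord P (S.reducedWord p.2) := by
    rw [hZH, e]
  have e2 : blMul P (S.ZH R p.1 p.2) = S.leftZ R p.1 ∘ₗ leftWord P (S.reducedWord p.2) := by
    simp [blMul, ZH]
  exact e1.trans e2.symm

end Uniqueness


/-! ### The Iwahori-Hecke algebra and its center -/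

variable (S) in
/-- The Iwahori-Hecke algebra `H`, spanned by the `Z^x H_w` with `x ∈ Y⁺`. -/
def hecke (R : Type*) [CommRing R] : Submodule R (S.BL R) :=
  Submodule.span R {a | ∃ x ∈ S.Yplus, ∃ w : S.W, a = S.ZH R x w}

/-- The center of `H`. -/
def Parameters.heckeCenter : Set (S.BL R) :=
  {z | z ∈ S.hecke R ∧ ∀ a ∈ S.hecke R, blMul P z a = blMul P a z}

variable (S) in
/-- The `W^v`-invariant part of the group algebra of a subgroup `L` of `Y`, inside `^{BL}H`: the finite
sums `∑_{x ∈ L} c_x Z^x` with `c_{w(x)} = c_x` for all `w ∈ W^v`. -/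
def groupAlgInvariants (R : Type*) [CommRing R] (L : Submodule ℤ Y) : Set (S.BL R) :=
  {z | ∃ c : Y →₀ R, (∀ x, c x ≠ 0 → x ∈ L) ∧ (∀ (w : S.W) x, c ((w : Y ≃ₗ[ℤ] Y) x) = c x) ∧
    z = c.sum fun x r => r • S.ZH R x 1}

variable (S) in
/-- The group algebra of a subgroup `L` of `Y`, inside `^{BL}H`. -/
def groupAlg (R : Type*) [CommRing R] (L : Submodule ℤ Y) : Set (S.BL R) :=
  {z | ∃ c : Y →₀ R, (∀ x, c x ≠ 0 → x ∈ L) ∧ z = c.sum fun x r => r • S.ZH R x 1}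

/-! ### Almost finite sets and the Looijenga algebra -/

section Completion

variable [Fintype I]

variable (S) in
/-- A set `E ⊆ Y` is almost finite if each of its elements is bounded, for `≤_{Q^∨}`, by an element of
a fixed finite set. -/
def AlmostFinite (E : Set Y) : Prop := ∃ J : Finset Y, ∀ x ∈ E, ∃ y ∈ J, S.leQ x y

variable (S) in
/-- The set of formal series `∑ a_x e^x` with almost finite support. -/
def looijenga (R : Type*) [CommRing R] : Set (Y → R) := {a | S.AlmostFinite {x | a x ≠ 0}}

/-- The product of formal series, `e^x e^y = e^{x + y}`. -/
def looijengaMul (a b : Y → R) : Y → R := fun z => ∑ᶠ x : Y, a x * b (z - x)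

variable (S) in
/-- The `W^v`-invariant part of the Looijenga algebra. -/
def looijengaInvariants (R : Type*) [CommRing R] : Set (Y → R) :=
  {a | a ∈ S.looijenga R ∧ ∀ x (w : S.W), a x = a ((w : Y ≃ₗ[ℤ] Y) x)}

/-! ### The completed Iwahori-Hecke algebra -/

variable (S) in
/-- `Ĥ`: the formal sums `∑ a_{x,w} Z^x H_w` over `Y⁺ × W^v` with almost finite support, that is, with
finite support along `W^v` and with `{x | a_{x,w} ≠ 0}` almost finite for every `w`. -/
def completedHecke (R : Type*) [CommRing R] : Set (Y × S.W → R) :=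
  {a | (∀ x w, a (x, w) ≠ 0 → x ∈ S.Yplus) ∧ {w | ∃ x, a (x, w) ≠ 0}.Finite ∧
    ∀ w, S.AlmostFinite {x | a (x, w) ≠ 0}}

variable (S) in
/-- The elements of `Ĥ` whose support along `Y` is bounded together with its `W^v`-orbits: there is a
finite `J ⊆ Y` such that for each `x` in the support some `y ∈ J` satisfies `w(x) ≤_{Q^∨} y` for all
`w ∈ W^v`, equivalently `x⁺⁺ ≤_{Q^∨} y`. -/
def boundedHecke (R : Type*) [CommRing R] : Set (Y × S.W → R) :=
  {a | a ∈ S.completedHecke R ∧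
    ∃ J : Finset Y, ∀ x w, a (x, w) ≠ 0 → ∃ y ∈ J, ∀ v : S.W, S.leQ ((v : Y ≃ₗ[ℤ] Y) x) y}

/-- The term `π_{q}(a_p b_{p'} Z^{x} H_{w} * Z^{x'} H_{w'})` of the convolution, for `p = (x, w)` and
`p' = (x', w')`. -/
def convTerm (a b : Y × S.W → R) (q : Y × S.W) (p : (Y × S.W) × (Y × S.W)) : R :=
  a p.1 * b p.2 * blMul P (S.ZH R p.1.1 p.1.2) (S.ZH R p.2.1 p.2.2) q

/-- The convolution of `a` and `b` is defined: each coefficient is a sum with finitely many non-zero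
terms. -/
def Parameters.ConvDefined (a b : Y × S.W → R) : Prop :=
  ∀ q, {p | convTerm P a b q p ≠ 0}.Finite

/-- The convolution `a * b`, meaningful if `P.ConvDefined a b`. -/
def Parameters.conv (a b : Y × S.W → R) : Y × S.W → R := fun q => ∑ᶠ p, convTerm P a b q p

/-- The center of a set `V` of formal sums: the elements of `V` whose convolutions with every
element of `V` are defined and commute. -/
def Parameters.convCenter (V : Set (Y × S.W → R)) : Set (Y × S.W → R) :=
  {z | z ∈ V ∧ ∀ a ∈ V, P.ConvDefined z a ∧ P.ConvDefined a z ∧ P.conv z a = P.conv a z}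

variable (S) in
open Classical in
/-- The identification of `∑ a_x e^x` with `∑ a_x Z^x`. -/
def ofLooijenga (a : Y → R) : Y × S.W → R := fun p => if p.2 = 1 then a p.1 else 0

end Completion

/-! ### Indecomposable components and the decomposition of the apartment -/

section Components

variable (S)

/-- The graph of the Kac-Moody matrix. -/
def graph : SimpleGraph I where
  Adj i j := i ≠ j ∧ S.A i j ≠ 0
  symm := ⟨fun i j h => ⟨h.1.symm, fun h' => h.2 ((S.A_zero i j).2 h')⟩⟩
  loopless := ⟨fun _ h => h.1 rfl⟩

/-- The indices of the indecomposable components of the Kac-Moody matrix. -/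
abbrev Component : Type _ := S.graph.ConnectedComponent

/-- The index set of an indecomposable component. -/
abbrev compIndex (c : S.Component) : Type _ := {i : I // S.graph.connectedComponentMk i = c}

/-- The indecomposable component of the Kac-Moody matrix, with real coefficients. -/
def compMatrix (c : S.Component) : Matrix (S.compIndex c) (S.compIndex c) ℝ :=
  Matrix.of fun i j => (S.A i j : ℝ)

open Classical in
/-- An indecomposable component is of finite type: `det B ≠ 0`, there is `u > 0` with `B u > 0`, and
`B v ≥ 0` implies `v > 0` or `v = 0` (all inequalities are coordinatewise). -/
def IsFiniteType [Fintype I] (c : S.Component) : Prop :=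
  (S.compMatrix c).det ≠ 0 ∧
  (∃ u : S.compIndex c → ℝ, (∀ i, 0 < u i) ∧ ∀ i, 0 < (S.compMatrix c).mulVec u i) ∧
  ∀ v : S.compIndex c → ℝ, (∀ i, 0 ≤ (S.compMatrix c).mulVec v i) → (∀ i, 0 < v i) ∨ v = 0

/-- The standard apartment `𝔸 = Y ⊗ ℝ`. -/
abbrev Apartment (Y : Type*) [AddCommGroup Y] : Type _ := ℝ ⊗[ℤ] Y

/-- The simple root `α_i` as a linear form on `𝔸`. -/
def realRoot (i : I) : Module.Dual ℝ (Apartment Y) := Module.Dual.baseChange ℝ (S.root i)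

/-- `Y ∩ V`, for a subspace `V` of `𝔸`. -/
def latticeInter (V : Submodule ℝ (Apartment Y)) : Submodule ℤ Y :=
  (V.restrictScalars ℤ).comap (TensorProduct.mk ℤ ℝ Y 1)

open Classical in
/-- A decomposition `𝔸 = ⨁ 𝔸_j` along the indecomposable components: `𝔸_j` contains the simple
coroots of the `j`-th component and is killed by the simple roots of the other components. -/
structure ApartmentDecomposition where
  /-- the summand `𝔸_j` -/
  space : S.Component → Submodule ℝ (Apartment Y)
  internal : DirectSum.IsInternal space
  coroot_mem : ∀ i, (1 : ℝ) ⊗ₜ[ℤ] S.coroot i ∈ space (S.graph.connectedComponentMk i)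
  root_eq_zero : ∀ i c, S.graph.connectedComponentMk i ≠ c → ∀ v ∈ space c, S.realRoot i v = 0

variable {S}

/-- `𝔸_{j,in}`, the inessential part of `𝔸_j`. -/
def ApartmentDecomposition.spaceIn (D : S.ApartmentDecomposition) (c : S.Component) :
    Submodule ℝ (Apartment Y) :=
  D.space c ⊓ ⨅ i : S.compIndex c, LinearMap.ker (S.realRoot i)

/-- `𝔸^f`, the sum of the `𝔸_j` of finite type. -/
def ApartmentDecomposition.finPart [Fintype I] (D : S.ApartmentDecomposition) :
    Submodule ℝ (Apartment Y) :=
  ⨆ (c : S.Component) (_ : S.IsFiniteType c), D.space c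

/-- `𝔸^∞_in`, the sum of the `𝔸_{j,in}` over the components that are not of finite type. -/
def ApartmentDecomposition.infInPart [Fintype I] (D : S.ApartmentDecomposition) :
    Submodule ℝ (Apartment Y) :=
  ⨆ (c : S.Component) (_ : ¬ S.IsFiniteType c), D.spaceIn c

/-- The lattice splits along the decomposition: `Y = ⨁ (Y ∩ 𝔸_j)`. -/
def ApartmentDecomposition.Splits (D : S.ApartmentDecomposition) : Prop :=
  ⨆ c : S.Component, latticeInter (D.space c) = ⊤

variable (S) in
/-- The `x ∈ Y` that are killed by the simple roots of all components that are not of finite type. -/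
def latticeFin [Fintype I] : Submodule ℤ Y :=
  ⨅ (i : I) (_ : ¬ S.IsFiniteType (S.graph.connectedComponentMk i)), LinearMap.ker (S.root i)

variable (S) in
/-- `Y_in`, the `x ∈ Y` that are killed by all simple roots. -/
def latticeIn : Submodule ℤ Y := ⨅ i : I, LinearMap.ker (S.root i)

end Components

end RootGeneratingSystem

end

/-! An invariant series commutes with every `Z^x`, and it commutes with `H_i` because the correction
term of (BL4) is antisymmetric under `x ↦ r_i(x)` (`bl4_refl`): in an invariant sum the terms of `x`
and `r_i(x)` cancel (`finsum_leftZ_bl4`), and induction on words gives `finsum_leftWord`.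

Conversely, let `z` commute with the `Z^x`, `x ∈ Y⁺`, and with the `H_w`, and let `w` have maximal
length in its support. The leading term of `H_w * Z^x` is `Z^{w(x)} H_w`, so the `w`-part of `z` is
invariant under translation by `x - w(x)`. An almost finite set contains no line in a coroot
direction, hence `w` fixes `Y⁺`, and so `w = 1`. Comparing the top coefficients in `z * H_w = H_w *
z` then gives invariance (`mem_invariants_of_commute`).

Infinite sums are controlled by `OrbitBounded`. Left multiplication by `H_i` moves the lattice part
along the coroot string from `x` to `r_i(x)`, which preserves an orbit bound, and a given string
carries only finitely many bounded elements; so all coefficients are finite sums. A stable almost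
finite set is orbit-bounded, and orbit-bounded elements lie in `Y⁺`. Conversely, each element of
`Y⁺` is orbit-bounded, since a dominant element is the largest of its orbit (`orbit_leQ`); this is
proved by a confluence argument in rank two.

For `H` itself, a central element is an invariant finite sum, so its support consists of finite
orbits. If `x` is dominant with finite orbit, then `-x` also climbs to a dominant element; the
coroot coefficients of the difference form a vector that forces finite type on every component with
a root not vanishing at `x` (`isFiniteType_of_dominant`). -/

namespace RootGeneratingSystem

/-! ### Simple reflections and their action on the lattice. -/

section WeylGroup

variable {I Y : Type*} [AddCommGroup Y] {S : RootGeneratingSystem I Y}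

theorem refl_apply (i : I) (x : Y) : S.refl i x = x - S.root i x • S.coroot i :=
  Module.reflection_apply _ _

@[simp]
theorem refl_refl (i : I) (x : Y) : S.refl i (S.refl i x) = x :=
  Module.involutive_reflection (S.root_coroot_self i) x

theorem root_coroot (i j : I) : S.root j (S.coroot i) = S.A i j := (S.pairing i j).symm

theorem root_refl (i j : I) (x : Y) :
    S.root j (S.refl i x) = S.root j x - S.root i x * S.A i j := by
  rw [refl_apply, map_sub, map_smul, root_coroot, smul_eq_mul]

theorem root_refl_self (i : I) (x : Y) : S.root i (S.refl i x) = -S.root i x := by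
  rw [root_refl, S.A_diag]; ring

theorem refl_eq_self {i : I} {y : Y} (h : S.root i y = 0) : S.refl i y = y := by
  rw [refl_apply, h, zero_smul, sub_zero]

theorem coe_s_apply (i : I) (x : Y) : ((S.s i : S.W) : Y ≃ₗ[ℤ] Y) x = S.refl i x := rfl

theorem coe_s_mul_apply (i : I) (w : S.W) (x : Y) :
    ((S.s i * w : S.W) : Y ≃ₗ[ℤ] Y) x = S.refl i ((w : Y ≃ₗ[ℤ] Y) x) := rfl

theorem coe_mul_apply (v w : S.W) (x : Y) :
    ((v * w : S.W) : Y ≃ₗ[ℤ] Y) x = (v : Y ≃ₗ[ℤ] Y) ((w : Y ≃ₗ[ℤ] Y) x) := rfl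

theorem coe_one_apply (x : Y) : ((1 : S.W) : Y ≃ₗ[ℤ] Y) x = x := rfl

theorem coe_inv_apply_apply (w : S.W) (x : Y) :
    ((w⁻¹ : S.W) : Y ≃ₗ[ℤ] Y) ((w : Y ≃ₗ[ℤ] Y) x) = x := by
  rw [← coe_mul_apply, inv_mul_cancel, coe_one_apply]

theorem coe_apply_inv_apply (w : S.W) (x : Y) :
    (w : Y ≃ₗ[ℤ] Y) (((w⁻¹ : S.W) : Y ≃ₗ[ℤ] Y) x) = x := by
  rw [← coe_mul_apply, mul_inv_cancel, coe_one_apply]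

/-- A property of elements of `Y` that is stable under the simple reflections is stable under
`W^v`. -/
theorem orbit_induction {p : Y → Prop} {x : Y} (hx : p x) (h : ∀ i y, p y → p (S.refl i y))
    (w : S.W) : p ((w : Y ≃ₗ[ℤ] Y) x) := by
  obtain ⟨l, rfl⟩ := S.exists_word w
  induction l with
  | nil => exact hx
  | cons i l ih =>
    rw [wordProd_cons, coe_s_mul_apply]
    exact h i _ ih

end WeylGroup

/-! ### The order defined by the coroots. -/

section Order

variable {I Y : Type*} [Fintype I] [AddCommGroup Y]

/-- The integral combinations of the simple coroots. -/
def corootComb (S : RootGeneratingSystem I Y) : (I → ℤ) →ₗ[ℤ] Y :=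
  Fintype.linearCombination ℤ S.coroot

variable {S : RootGeneratingSystem I Y}

theorem corootComb_apply (m : I → ℤ) : S.corootComb m = ∑ i, m i • S.coroot i := by
  rw [corootComb, Fintype.linearCombination_apply]

theorem corootComb_single [DecidableEq I] (i : I) (n : ℤ) :
    S.corootComb (Pi.single i n) = n • S.coroot i := by
  rw [corootComb, Fintype.linearCombination_apply_single]

theorem corootComb_injective : Function.Injective S.corootComb :=
  (injective_iff_map_eq_zero _).2 fun m hm => funext
    (Fintype.linearIndependent_iff.1 S.coroot_free m (by rwa [← corootComb_apply]))

theorem leQ_iff {x y : Y} : S.leQ x y ↔ ∃ m : I → ℤ, 0 ≤ m ∧ y - x = S.corootComb m := by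
  constructor
  · rintro ⟨n, hn⟩
    refine ⟨fun i => n i, fun i => Int.natCast_nonneg _, ?_⟩
    simp [hn, corootComb_apply]
  · rintro ⟨m, hm, h⟩
    refine ⟨fun i => (m i).toNat, ?_⟩
    rw [h, corootComb_apply]
    refine Finset.sum_congr rfl fun i _ => ?_
    rw [← natCast_zsmul, Int.toNat_of_nonneg (hm i)]

theorem leQ_refl (x : Y) : S.leQ x x := leQ_iff.2 ⟨0, le_rfl, by simp⟩

theorem leQ_trans {x y z : Y} (h : S.leQ x y) (h' : S.leQ y z) : S.leQ x z := by
  obtain ⟨m, hm, e⟩ := leQ_iff.1 h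
  obtain ⟨m', hm', e'⟩ := leQ_iff.1 h'
  exact leQ_iff.2 ⟨m + m', add_nonneg hm hm', by rw [map_add, ← e, ← e']; abel⟩

theorem leQ_add {x y x' y' : Y} (h : S.leQ x y) (h' : S.leQ x' y') :
    S.leQ (x + x') (y + y') := by
  obtain ⟨m, hm, e⟩ := leQ_iff.1 h
  obtain ⟨m', hm', e'⟩ := leQ_iff.1 h'
  exact leQ_iff.2 ⟨m + m', add_nonneg hm hm', by rw [map_add, ← e, ← e']; abel⟩

theorem leQ_sub_comm {x y z : Y} (h : S.leQ (x - y) z) : S.leQ (x - z) y := by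
  obtain ⟨m, hm, e⟩ := leQ_iff.1 h
  exact leQ_iff.2 ⟨m, hm, by rw [← e]; abel⟩

theorem leQ_sub_smul (i : I) (x : Y) {n : ℤ} (hn : 0 ≤ n) : S.leQ (x - n • S.coroot i) x := by
  classical
  refine leQ_iff.2 ⟨Pi.single i n, ?_, by rw [corootComb_single]; abel⟩
  simpa using hn

theorem refl_leQ {i : I} {x : Y} (h : 0 ≤ S.root i x) : S.leQ (S.refl i x) x := by
  rw [refl_apply]
  exact leQ_sub_smul i x h

theorem leQ_refl_of_nonpos {i : I} {x : Y} (h : S.root i x ≤ 0) : S.leQ x (S.refl i x) := by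
  have h1 : S.leQ (S.refl i (S.refl i x)) (S.refl i x) :=
    refl_leQ (by rw [root_refl_self]; omega)
  rwa [refl_refl] at h1

theorem leQ_antisymm {x y : Y} (h : S.leQ x y) (h' : S.leQ y x) : x = y := by
  obtain ⟨m, hm, e⟩ := leQ_iff.1 h
  obtain ⟨m', hm', e'⟩ := leQ_iff.1 h'
  have h0 : m + m' = 0 := corootComb_injective (S := S) (by rw [map_add, ← e, ← e', map_zero]; abel)
  have : m = 0 := by
    ext i
    have h1 := congrFun h0 i
    have h2 := hm i
    have h3 := hm' i
    simp only [Pi.add_apply, Pi.zero_apply] at h1 h2 h3 ⊢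
    omega
  rw [this, map_zero, sub_eq_zero] at e
  exact e.symm

theorem finite_interval (x y : Y) : {z | S.leQ x z ∧ S.leQ z y}.Finite := by
  classical
  by_cases h : S.leQ x y
  · obtain ⟨M, hM, e⟩ := leQ_iff.1 h
    refine ((Set.finite_Icc (0 : I → ℤ) M).image fun m => x + S.corootComb m).subset ?_
    rintro z ⟨h1, h2⟩
    obtain ⟨m, hm, e1⟩ := leQ_iff.1 h1
    obtain ⟨m', hm', e2⟩ := leQ_iff.1 h2
    have : M = m + m' := corootComb_injective (S := S) (by rw [map_add, ← e, ← e1, ← e2]; abel)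
    exact ⟨m, ⟨hm, this ▸ le_add_of_nonneg_right hm'⟩, by simp [← e1]⟩
  · convert Set.finite_empty
    ext z
    simp only [Set.mem_ofPred_eq, Set.mem_empty_iff_false, iff_false]
    exact fun hz => h (leQ_trans hz.1 hz.2)

/-- Coroot strings are convex for the order. -/
theorem leQ_sub_smul_of_mem_uIcc {x y : Y} {b : I → ℤ} {n k : ℤ} (hk : k ∈ Set.uIcc 0 n)
    (h0 : S.leQ x y) (hn : S.leQ (x - n • S.corootComb b) y) :
    S.leQ (x - k • S.corootComb b) y := by
  obtain ⟨m, hm, e⟩ := leQ_iff.1 h0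
  obtain ⟨m', hm', e'⟩ := leQ_iff.1 hn
  have h1 : m' = m + n • b := corootComb_injective (S := S) (by
    rw [map_add, map_smul, ← e, ← e']; abel)
  -- Each coefficient `m i + k * b i` is affine in `k` and nonnegative at `0` and at `n`.
  refine leQ_iff.2 ⟨m + k • b, fun i => ?_, by rw [map_add, map_smul, ← e]; abel⟩
  have h2 := hm i
  have h3 := hm' i
  rw [h1] at h3
  simp only [Pi.zero_apply, Pi.add_apply, Pi.smul_apply, smul_eq_mul] at h2 h3 ⊢
  rcases Set.mem_uIcc.1 hk with ⟨hk0, hkn⟩ | ⟨hkn, hk0⟩ <;> rcases le_total 0 (b i) with hb | hb <;>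
    nlinarith

theorem coroot_eq_corootComb (i : I) : ∃ m, S.coroot i = S.corootComb m := by
  classical
  exact ⟨Pi.single i 1, by rw [corootComb_single, one_smul]⟩

/-- Orbits stay in one coset of the coroot lattice, so a bound attached to a coset serves a whole
orbit. -/
theorem sub_mem_range_corootComb (x : Y) (w : S.W) :
    ∃ m, (w : Y ≃ₗ[ℤ] Y) x - x = S.corootComb m := by
  refine orbit_induction (p := fun y => ∃ m, y - x = S.corootComb m) ⟨0, by simp⟩ ?_ w
  rintro i y ⟨m, hm⟩
  obtain ⟨m', hm'⟩ := coroot_eq_corootComb (S := S) i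
  exact ⟨m - S.root i y • m', by rw [map_sub, map_smul, ← hm, ← hm', refl_apply]; abel⟩

theorem coe_corootComb (w : S.W) (m : I → ℤ) :
    ∃ m', (w : Y ≃ₗ[ℤ] Y) (S.corootComb m) = S.corootComb m' := by
  obtain ⟨m', h⟩ := sub_mem_range_corootComb (S.corootComb m) w
  exact ⟨m' + m, by rw [map_add, ← h]; abel⟩

end Order

/-! ### Dominant elements are maximal in their orbits. -/

section Dominant

variable {I Y : Type*} [AddCommGroup Y] {S : RootGeneratingSystem I Y}

/-- The elements that are reached from `x` by simple reflections that decrease them. -/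
inductive Descends (S : RootGeneratingSystem I Y) (x : Y) : Y → Prop
  | base : Descends S x x
  | step (i : I) (y : Y) : Descends S x y → 0 < S.root i y → Descends S x (S.refl i y)

theorem Descends.refl_of_nonneg {x y : Y} (h : S.Descends x y) {i : I} (hi : 0 ≤ S.root i y) :
    S.Descends x (S.refl i y) := by
  rcases hi.eq_or_lt with h0 | h0
  · rwa [refl_eq_self h0.symm]
  · exact h.step i y h0

variable [Fintype I]

theorem Descends.leQ {x y : Y} (h : S.Descends x y) : S.leQ y x := by
  induction h with
  | base => exact leQ_refl x
  | step i y _ hi ih => exact leQ_trans (refl_leQ hi.le) ih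

/-- `y` lies at height `n` below `x`. -/
def HeightBelow (S : RootGeneratingSystem I Y) (x y : Y) (n : ℤ) : Prop :=
  ∃ m : I → ℤ, x - y = S.corootComb m ∧ n = ∑ i, m i

theorem Descends.heightBelow {x y : Y} (h : S.Descends x y) : ∃ n, 0 ≤ n ∧ S.HeightBelow x y n := by
  obtain ⟨m, hm, e⟩ := leQ_iff.1 h.leQ
  exact ⟨_, Finset.sum_nonneg fun i _ => hm i, m, e, rfl⟩

theorem HeightBelow.refl {x y : Y} {n : ℤ} (h : S.HeightBelow x y n) (i : I) :
    S.HeightBelow x (S.refl i y) (n + S.root i y) := by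
  classical
  obtain ⟨m, e, rfl⟩ := h
  refine ⟨m + Pi.single i (S.root i y), ?_, ?_⟩
  · rw [map_add, ← e, corootComb_single, refl_apply]; abel
  · simp [Finset.sum_add_distrib]

theorem HeightBelow.nonneg {x y : Y} {n : ℤ} (h : S.HeightBelow x y n) (hy : S.Descends x y) :
    0 ≤ n := by
  obtain ⟨m, e, rfl⟩ := h
  obtain ⟨m', hm', e'⟩ := leQ_iff.1 hy.leQ
  rw [corootComb_injective (e.symm.trans e')]
  exact Finset.sum_nonneg fun i _ => hm' i

/-- In an infinite dihedral subgroup, going up from an antidominant element never stops. -/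
theorem not_descends_of_four_le {x : Y} {N : ℤ}
    (hup : ∀ y n, S.Descends x y → S.HeightBelow x y n → n < N → ∀ i, S.root i y ≤ 0 →
      S.Descends x (S.refl i y))
    (k : ℕ) : ∀ (i j : I) (y : Y) (n : ℤ), 4 ≤ S.A i j * S.A j i → S.A i j ≤ 0 → S.A j i ≤ 0 →
      S.Descends x y → S.HeightBelow x y n → n < N → n ≤ k → S.root i y < 0 → 0 ≤ S.root j y →
      S.root j y * (-S.A j i) ≤ -2 * S.root i y → False := by
  induction k with
  | zero =>
    intro i j y n _ _ _ hy hn hN hk hi _ _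
    have h1 := (hn.refl i).nonneg (hup y n hy hn hN i hi.le)
    simp only [Nat.cast_zero] at hk
    omega
  | succ k ih =>
    intro i j y n h4 hij hji hy hn hN hk hi hj h2
    push_cast at hk
    have h3 := hup y n hy hn hN i hi.le
    -- Since the product of the two matrix entries is at least 4, the inequalities reproduce
    -- themselves at `r_i(y)` with `i` and `j` exchanged. The height drops at each round but cannot
    -- become negative.
    have hlt : S.root j y - S.root i y * S.A i j < 0 := by
      by_contra hcon
      push Not at hcon
      nlinarith
    refine ih j i _ _ (by rwa [mul_comm]) hji hij h3 (hn.refl i) (by omega) (by omega) ?_ ?_ ?_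
    · rw [root_refl]; exact hlt
    · rw [root_refl_self]; omega
    · rw [root_refl_self, root_refl]; nlinarith

/-- Confluence in a finite dihedral group, in the coordinates of `y + a α_i^∨ + b α_j^∨`: from an
antidominant element `y`, going up through `r_j` first and then down again leads to `r_i(y)`. -/
theorem rank_two_confluence {p q u v : ℤ} (hp : 0 ≤ p) (hq : 0 ≤ q) (hpq : p * q < 4)
    (h0 : p = 0 ↔ q = 0) (hu : 0 ≤ u) (hv : 0 ≤ v) {U D : ℤ → ℤ → Prop}
    (hUD : ∀ a b, U a b → D a b)
    (hUi : ∀ a b, U a b → 2 * a - q * b ≤ u → U (u - a + q * b) b)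
    (hUj : ∀ a b, U a b → 2 * b - p * a ≤ v → U a (v - b + p * a))
    (hDi : ∀ a b, D a b → u ≤ 2 * a - q * b → D (u - a + q * b) b)
    (hDj : ∀ a b, D a b → v ≤ 2 * b - p * a → D a (v - b + p * a))
    (h : U 0 v) : D u 0 := by
  -- The two alternating paths from `y` to the top of its dihedral orbit have length 2, 3, 4, 6 for
  -- `p * q = 0, 1, 2, 3`. One climbs along the path that starts with `r_j` and descends along the
  -- other, stopping one step before `y`.
  have h1 := hUi _ _ h (by nlinarith)
  rcases hp.eq_or_lt with rfl | hp
  · obtain rfl : q = 0 := h0.1 rfl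
    convert hDj _ _ (hUD _ _ h1) (by linarith) using 1 <;> ring
  have hq : 0 < q := lt_of_le_of_ne hq fun h => hp.ne' (h0.2 h.symm)
  have hp3 : p ≤ 3 := by nlinarith
  have hq3 : q ≤ 3 := by nlinarith
  have h1pq : 0 ≤ p * q - 1 := by nlinarith
  have h2 := hUj _ _ h1 (by nlinarith [mul_nonneg hp.le hu, mul_nonneg h1pq hv])
  by_cases h11 : p * q = 1
  · obtain rfl : p = 1 := by nlinarith
    obtain rfl : q = 1 := by linarith
    convert hDj _ _ (hDi _ _ (hUD _ _ h2) (by linarith)) (by linarith) using 1 <;> ring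
  by_cases h12 : p * q = 2
  · have hc : (p = 1 ∧ q = 2) ∨ (p = 2 ∧ q = 1) := by
      interval_cases p <;> omega
    rcases hc with ⟨rfl, rfl⟩ | ⟨rfl, rfl⟩ <;>
    · have h3 := hUi _ _ h2 (by linarith)
      convert hDj _ _ (hDi _ _ (hDj _ _ (hUD _ _ h3) (by linarith)) (by linarith)) (by linarith)
        using 1 <;> ring
  · have hc : (p = 1 ∧ q = 3) ∨ (p = 3 ∧ q = 1) := by
      interval_cases p <;> omega
    rcases hc with ⟨rfl, rfl⟩ | ⟨rfl, rfl⟩ <;>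
    · have h3 := hUi _ _ h2 (by linarith)
      have h4 := hUj _ _ h3 (by linarith)
      have h5 := hUi _ _ h4 (by linarith)
      have d1 := hDj _ _ (hUD _ _ h5) (by linarith)
      have d2 := hDi _ _ d1 (by linarith)
      have d3 := hDj _ _ d2 (by linarith)
      have d4 := hDi _ _ d3 (by linarith)
      convert hDj _ _ d4 (by linarith) using 1 <;> ring

/-- The elements below a dominant element that are reached by decreasing reflections are stable
under increasing reflections. -/
theorem Descends.refl_of_nonpos {x : Y} (hx : ∀ i, 0 ≤ S.root i x) (k : ℕ) :
    ∀ y n, S.Descends x y → S.HeightBelow x y n → n < k → ∀ i, S.root i y ≤ 0 →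
      S.Descends x (S.refl i y) := by
  induction k with
  | zero =>
    intro y n hy hn hk
    have := hn.nonneg hy
    simp only [Nat.cast_zero] at hk
    omega
  | succ k ih =>
    intro y n hy hn hk i hi
    push_cast at hk
    rcases hi.eq_or_lt with hi0 | hi0
    · rwa [refl_eq_self hi0]
    cases hy with
    | base => have := hx i; omega
    | step j y' hy' hj =>
      by_cases hij : i = j
      · subst hij
        rwa [refl_refl]
      -- The predecessor of `y` is `r_j(y)`, of smaller height, so the induction hypothesis allows
      -- climbing from there. What remains concerns only the dihedral group generated by `r_i` and
      -- `r_j`.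
      set y := S.refl j y' with hyy
      have hy' : S.Descends x (S.refl j y) := by rwa [hyy, refl_refl]
      have hj : S.root j y < 0 := by rw [hyy, root_refl_self]; omega
      clear_value y
      have hA := S.A_offdiag i j hij
      have hA' := S.A_offdiag j i (Ne.symm hij)
      have hn' := hn.refl j
      rcases le_or_gt 4 (S.A i j * S.A j i) with h4 | h4
      · exfalso
        have hri : S.root i (S.refl j y) < 0 := by rw [root_refl]; nlinarith
        obtain ⟨m, hm⟩ := Int.eq_ofNat_of_zero_le (hn'.nonneg hy')
        refine not_descends_of_four_le ih m i j (S.refl j y) _ h4 hA hA' hy' hn' (by omega) hm.le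
          hri (by rw [root_refl_self]; omega) ?_
        rw [root_refl_self j, root_refl j i]
        nlinarith
      · set c : ℤ → ℤ → Y := fun a b => y + a • S.coroot i + b • S.coroot j with hc
        have ci : ∀ a b, S.root i (c a b) = S.root i y + 2 * a + b * S.A j i := fun a b => by
          simp only [hc, map_add, map_smul, root_coroot, S.A_diag, smul_eq_mul]; ring
        have cj : ∀ a b, S.root j (c a b) = S.root j y + 2 * b + a * S.A i j := fun a b => by
          simp only [hc, map_add, map_smul, root_coroot, S.A_diag, smul_eq_mul]; ring
        have ri : ∀ a b, S.refl i (c a b) = c (-S.root i y - a + (-S.A j i) * b) b := fun a b => by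
          rw [refl_apply, ci]; simp only [hc]; module
        have rj : ∀ a b, S.refl j (c a b) = c a (-S.root j y - b + (-S.A i j) * a) := fun a b => by
          rw [refl_apply, cj]; simp only [hc]; module
        have c0 : y = c 0 0 := by simp [hc]
        -- `U` carries a height below `k`, so that the induction hypothesis permits going up; `D`
        -- carries none, since going down is always permitted.
        have key := rank_two_confluence (p := -S.A i j) (q := -S.A j i) (u := -S.root i y)
          (v := -S.root j y) (by omega) (by omega) (by linarith)
          (by rw [neg_eq_zero, neg_eq_zero, S.A_zero]) (by omega) (by omega)
          (U := fun a b => S.Descends x (c a b) ∧ ∃ n : ℤ, n < k ∧ S.HeightBelow x (c a b) n)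
          (D := fun a b => S.Descends x (c a b)) (fun _ _ h => h.1)
          (fun a b ⟨h, n, hn, hh⟩ hle => by
            have hle' : S.root i (c a b) ≤ 0 := by rw [ci]; linarith
            rw [← ri]
            exact ⟨ih _ _ h hh hn i hle', _, by omega, hh.refl i⟩)
          (fun a b ⟨h, n, hn, hh⟩ hle => by
            have hle' : S.root j (c a b) ≤ 0 := by rw [cj]; linarith
            rw [← rj]
            exact ⟨ih _ _ h hh hn j hle', _, by omega, hh.refl j⟩)
          (fun a b h hle => by
            rw [← ri]
            exact h.refl_of_nonneg (by rw [ci]; linarith))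
          (fun a b h hle => by
            rw [← rj]
            exact h.refl_of_nonneg (by rw [cj]; linarith))
          (by
            have e : c 0 (-S.root j y) = S.refl j y := by
              rw [refl_apply]; simp only [hc]; module
            rw [e]
            exact ⟨hy', _, by omega, hn'⟩)
        have e : c (-S.root i y) 0 = S.refl i y := by
          rw [refl_apply]; simp only [hc]; module
        rwa [e] at key

/-- A dominant element is the largest one of its orbit. -/
theorem orbit_leQ {x : Y} (hx : ∀ i, 0 ≤ S.root i x) (w : S.W) :
    S.leQ ((w : Y ≃ₗ[ℤ] Y) x) x := by
  refine Descends.leQ (orbit_induction (p := S.Descends x) .base (fun i y hy => ?_) w)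
  rcases le_total 0 (S.root i y) with h | h
  · exact hy.refl_of_nonneg h
  · obtain ⟨n, hn, hh⟩ := hy.heightBelow
    exact Descends.refl_of_nonpos hx (n.toNat + 1) y n hy hh (by omega) i h

/-- If only finitely many elements of the orbit of `x` lie above `x`, then one of them is
dominant. -/
theorem exists_dominant_of_finite {x : Y}
    (h : {y | S.leQ x y ∧ ∃ w : S.W, (w : Y ≃ₗ[ℤ] Y) x = y}.Finite) :
    ∃ w : S.W, S.leQ x ((w : Y ≃ₗ[ℤ] Y) x) ∧ ∀ i, 0 ≤ S.root i ((w : Y ≃ₗ[ℤ] Y) x) := by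
  let _ : PartialOrder Y :=
    { le := S.leQ, le_refl := leQ_refl, le_trans := fun _ _ _ => leQ_trans,
      le_antisymm := fun _ _ => leQ_antisymm }
  -- A maximal element is dominant: a negative value of `α_i` would make `r_i` raise it strictly.
  obtain ⟨y, hy⟩ := h.exists_maximal ⟨x, leQ_refl x, 1, rfl⟩
  obtain ⟨hxy, w, rfl⟩ := hy.prop
  refine ⟨w, hxy, fun i => ?_⟩
  by_contra hi
  push Not at hi
  have h1 : S.leQ ((w : Y ≃ₗ[ℤ] Y) x) (S.refl i ((w : Y ≃ₗ[ℤ] Y) x)) := leQ_refl_of_nonpos hi.le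
  have h2 : S.leQ (S.refl i ((w : Y ≃ₗ[ℤ] Y) x)) ((w : Y ≃ₗ[ℤ] Y) x) :=
    hy.le_of_ge ⟨leQ_trans hxy h1, S.s i * w, rfl⟩ h1
  have h3 := congrArg (S.root i) (leQ_antisymm h1 h2)
  rw [root_refl_self] at h3
  omega

end Dominant

/-! ### Bounded orbits and almost finite sets. -/

section OrbitBounded

variable {I Y : Type*} [Fintype I] [AddCommGroup Y]

/-- The orbit of `x` is bounded above by an element of `J`. -/
def OrbitBounded (S : RootGeneratingSystem I Y) (J : Finset Y) (x : Y) : Prop :=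
  ∃ y ∈ J, ∀ v : S.W, S.leQ ((v : Y ≃ₗ[ℤ] Y) x) y

variable {S : RootGeneratingSystem I Y} {J J' : Finset Y} {x x' : Y}

theorem OrbitBounded.exists_leQ (h : S.OrbitBounded J x) : ∃ y ∈ J, S.leQ x y :=
  let ⟨y, hy, h⟩ := h
  ⟨y, hy, h 1⟩

theorem OrbitBounded.almostFinite (S : RootGeneratingSystem I Y) (J : Finset Y) :
    S.AlmostFinite {x | S.OrbitBounded J x} :=
  ⟨J, fun _ hx => hx.exists_leQ⟩

theorem OrbitBounded.add [DecidableEq Y] (h : S.OrbitBounded J x) (h' : S.OrbitBounded J' x') :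
    S.OrbitBounded (Finset.image₂ (· + ·) J J') (x + x') := by
  obtain ⟨y, hy, h⟩ := h
  obtain ⟨y', hy', h'⟩ := h'
  refine ⟨y + y', Finset.mem_image₂_of_mem hy hy', fun v => ?_⟩
  rw [map_add]
  exact leQ_add (h v) (h' v)

/-- Keeping `J` unchanged lets both sides of `finsum_leftWord` be restricted to the same finite set
of coordinates. -/
theorem OrbitBounded.add_of_zero (h : S.OrbitBounded J x) (h' : S.OrbitBounded {0} x') :
    S.OrbitBounded J (x + x') := by
  obtain ⟨y, hy, h⟩ := h
  obtain ⟨y', hy', h'⟩ := h'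
  obtain rfl := Finset.mem_singleton.1 hy'
  refine ⟨y, hy, fun v => ?_⟩
  rw [map_add, ← add_zero y]
  exact leQ_add (h v) (h' v)

theorem orbitBounded_zero : S.OrbitBounded {0} 0 :=
  ⟨0, by simp, fun v => by rw [map_zero]; exact leQ_refl 0⟩

/-- For each `v`, the bound holds at both ends `v(x)` and `v(r_i(x))` of the translated string, and
strings are convex for the order. -/
theorem OrbitBounded.string (h : S.OrbitBounded J x) {i : I} {k : ℤ}
    (hk : k ∈ Set.uIcc 0 (S.root i x)) : S.OrbitBounded J (x - k • S.coroot i) := by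
  obtain ⟨y, hy, h⟩ := h
  refine ⟨y, hy, fun v => ?_⟩
  obtain ⟨m, hm⟩ := coroot_eq_corootComb (S := S) i
  obtain ⟨m', hm'⟩ := coe_corootComb v m
  rw [map_sub, map_smul, hm, hm']
  refine leQ_sub_smul_of_mem_uIcc hk (h v) ?_
  have h1 := h (v * S.s i)
  rwa [coe_mul_apply, coe_s_apply, refl_apply, map_sub, map_smul, hm, hm'] at h1

/-- The orbit elements above `x` lie in an interval, which is finite, so one of them is dominant. -/
theorem OrbitBounded.mem_Yplus (h : S.OrbitBounded J x) : x ∈ S.Yplus := by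
  obtain ⟨y, _, h⟩ := h
  obtain ⟨w, _, hw⟩ := exists_dominant_of_finite (x := x) (S := S)
    ((finite_interval (S := S) x y).subset fun z ⟨hz, w, hw⟩ => ⟨hz, hw ▸ h w⟩)
  exact ⟨w, hw⟩

/-- The maximality of dominant elements enters here; it places every `Z^x H_w` with `x ∈ Y⁺` in
`boundedHecke`. -/
theorem exists_orbitBounded (hx : x ∈ S.Yplus) : ∃ y, S.OrbitBounded {y} x := by
  obtain ⟨w, hw⟩ := hx
  refine ⟨(w : Y ≃ₗ[ℤ] Y) x, _, Finset.mem_singleton_self _, fun v => ?_⟩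
  have h1 := orbit_leQ hw (v * w⁻¹)
  rwa [coe_mul_apply, coe_inv_apply_apply] at h1

/-- Only finitely many elements with orbit bounded by `J` lie on a given coroot string. -/
theorem finite_orbitBounded_string (J : Finset Y) (i : I) (y : Y) :
    {x | S.OrbitBounded J x ∧ ∃ k : ℤ, y = x - k • S.coroot i}.Finite := by
  -- The sum `x + r_i(x)` is constant along the string, equal to `y + r_i(y)`. Hence `r_i(x) ≤ z`
  -- turns into the lower bound `y + r_i(y) - z ≤ x`.
  refine (J.finite_toSet.biUnion fun z _ =>
    finite_interval (S := S) (y + S.refl i y - z) z).subset ?_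
  rintro x ⟨⟨z, hz, h⟩, k, rfl⟩
  refine Set.mem_biUnion hz ⟨?_, h 1⟩
  have h1 := h (S.s i)
  rw [coe_s_apply] at h1
  refine leQ_sub_comm ?_
  convert h1 using 1
  simp only [refl_apply, map_sub, map_smul, S.root_coroot_self]
  module

theorem AlmostFinite.mono {E E' : Set Y} (h : S.AlmostFinite E') (hE : E ⊆ E') :
    S.AlmostFinite E :=
  let ⟨J, hJ⟩ := h
  ⟨J, fun x hx => hJ x (hE hx)⟩

theorem AlmostFinite.of_finite {E : Set Y} (h : E.Finite) : S.AlmostFinite E :=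
  ⟨h.toFinset, fun x hx => ⟨x, h.mem_toFinset.2 hx, leQ_refl x⟩⟩

/-- Upper bounds `y` of `x` and `y'` of `z - x` confine `x` to the finite interval from `z - y'` to
`y`. -/
theorem AlmostFinite.finite_sub {E E' : Set Y} (h : S.AlmostFinite E) (h' : S.AlmostFinite E')
    (z : Y) : {x | x ∈ E ∧ z - x ∈ E'}.Finite := by
  obtain ⟨J, hJ⟩ := h
  obtain ⟨J', hJ'⟩ := h'
  refine (J.finite_toSet.biUnion fun y _ => J'.finite_toSet.biUnion fun y' _ =>
    finite_interval (S := S) (z - y') y).subset ?_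
  rintro x ⟨hx, hx'⟩
  obtain ⟨y, hy, h1⟩ := hJ x hx
  obtain ⟨y', hy', h2⟩ := hJ' _ hx'
  exact Set.mem_biUnion hy (Set.mem_biUnion hy' ⟨leQ_sub_comm h2, h1⟩)

/-- A finite set has a bound that is uniform along each coset of the coroot lattice. -/
theorem exists_coset_bound (J : Finset Y) (y : Y) :
    ∃ z, ∀ y' ∈ J, (∃ m, y' - y = S.corootComb m) → S.leQ y' z := by
  classical
  induction J using Finset.induction_on with
  | empty => exact ⟨y, by simp⟩
  | insert a J _ ih =>
    obtain ⟨z, hz⟩ := ih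
    -- If `a` and the old bound both lie in the coset of `y`, take the coefficientwise maximum.
    -- Otherwise at most one of them matters: if `a` lies in the coset and `z` does not, no earlier
    -- element can lie there.
    by_cases h : (∃ m, a - y = S.corootComb m) ∧ ∃ m, z - y = S.corootComb m
    · obtain ⟨⟨m, hm⟩, m', hm'⟩ := h
      refine ⟨y + S.corootComb (m ⊔ m'), fun y' hy' h => ?_⟩
      rcases Finset.mem_insert.1 hy' with rfl | hy'
      · refine leQ_iff.2 ⟨m ⊔ m' - m, sub_nonneg.2 le_sup_left, ?_⟩
        rw [map_sub, ← hm]; abel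
      · refine leQ_trans (hz y' hy' h) (leQ_iff.2 ⟨m ⊔ m' - m', sub_nonneg.2 le_sup_right, ?_⟩)
        rw [map_sub, ← hm']; abel
    · by_cases ha : ∃ m, a - y = S.corootComb m
      · refine ⟨a, fun y' hy' h' => ?_⟩
        rcases Finset.mem_insert.1 hy' with rfl | hy'
        · exact leQ_refl _
        · exfalso
          obtain ⟨m, hm⟩ := h'
          obtain ⟨m', _, hm'⟩ := leQ_iff.1 (hz y' hy' ⟨m, hm⟩)
          exact h ⟨ha, m' + m, by rw [map_add, ← hm, ← hm']; abel⟩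
      · refine ⟨z, fun y' hy' hcoset => ?_⟩
        rcases Finset.mem_insert.1 hy' with rfl | hy'
        · exact absurd hcoset ha
        · exact hz y' hy' hcoset

/-- A `W^v`-stable almost finite set is bounded along with its orbits. -/
theorem AlmostFinite.orbitBounded {E : Set Y} (h : S.AlmostFinite E)
    (hE : ∀ x ∈ E, ∀ w : S.W, (w : Y ≃ₗ[ℤ] Y) x ∈ E) :
    ∃ J : Finset Y, ∀ x ∈ E, S.OrbitBounded J x := by
  classical
  obtain ⟨J, hJ⟩ := h
  choose f hf using exists_coset_bound (S := S) J
  refine ⟨J.image f, fun x hx => ?_⟩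
  obtain ⟨y, hy, hxy⟩ := hJ x hx
  refine ⟨f y, Finset.mem_image_of_mem f hy, fun v => ?_⟩
  obtain ⟨y', hy', h'⟩ := hJ _ (hE x hx v)
  -- The bound `y'` depends on `v`, but it stays in the coset of `y`, so `f y` dominates all of
  -- them.
  refine leQ_trans h' (hf y y' hy' ?_)
  obtain ⟨m, _, hm⟩ := leQ_iff.1 hxy
  obtain ⟨m', _, hm'⟩ := leQ_iff.1 h'
  obtain ⟨n, hn⟩ := sub_mem_range_corootComb x v
  exact ⟨m' + n - m, by rw [map_sub, map_add, ← hm, ← hm', ← hn]; abel⟩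

end OrbitBounded

/-! ### Supports of products and finiteness of convolutions. -/

section Supports

variable {I Y R : Type*} [AddCommGroup Y] [CommRing R] {S : RootGeneratingSystem I Y}
  (P : S.Parameters R)

open Classical in
theorem ZH_apply (x : Y) (w : S.W) (q : Y × S.W) :
    S.ZH R x w q = if (x, w) = q then 1 else 0 := by
  rw [ZH, Finsupp.single_apply]

theorem eq_of_ZH_apply_ne_zero {x : Y} {w : S.W} {q : Y × S.W} (h : S.ZH R x w q ≠ 0) :
    q = (x, w) := by
  by_contra hq
  exact h (by rw [ZH_apply, if_neg (Ne.symm hq)])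

theorem apply_eq_sum (T : S.BL R →ₗ[R] S.BL R) (h : S.BL R) (q : Y × S.W) :
    T h q = h.sum fun p r => r * T (S.ZH R p.1 p.2) q := by
  conv_lhs => rw [← Finsupp.sum_single h, Finsupp.sum, map_sum, Finsupp.finsetSum_apply]
  refine Finset.sum_congr rfl fun p _ => ?_
  have : Finsupp.single p (h p) = h p • S.ZH R p.1 p.2 := by simp [ZH]
  rw [this, map_smul, Finsupp.smul_apply, smul_eq_mul]

theorem exists_of_apply_ne_zero (T : S.BL R →ₗ[R] S.BL R) {h : S.BL R} {q : Y × S.W}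
    (hq : T h q ≠ 0) : ∃ p, h p ≠ 0 ∧ T (S.ZH R p.1 p.2) q ≠ 0 := by
  rw [apply_eq_sum] at hq
  obtain ⟨p, hp, h1⟩ := Finset.exists_ne_zero_of_sum_ne_zero hq
  exact ⟨p, Finsupp.mem_support_iff.1 hp, right_ne_zero_of_mul h1⟩

theorem leftH_ZH (i : I) (x : Y) (w : S.W) :
    leftH P i (S.ZH R x w) = bl2 P i (S.refl i x) w + bl4 P i x w := by
  simp [leftH, ZH]

theorem bl2_apply_ne_zero {i : I} {x : Y} {w : S.W} {q : Y × S.W} (h : bl2 P i x w q ≠ 0) :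
    q = (x, S.s i * w) ∨ q = (x, w) := by
  rw [bl2] at h
  split_ifs at h
  · exact Or.inl (eq_of_ZH_apply_ne_zero h)
  · rw [Finsupp.add_apply, Finsupp.smul_apply, smul_eq_mul] at h
    by_cases h1 : S.ZH R x w q = 0
    · rw [h1, mul_zero, zero_add] at h
      exact Or.inl (eq_of_ZH_apply_ne_zero h)
    · exact Or.inr (eq_of_ZH_apply_ne_zero h1)

theorem blSum_apply_ne_zero {i : I} {x : Y} {n : ℕ} {w : S.W} {q : Y × S.W}
    (h : blSum P i x n w q ≠ 0) : q.2 = w ∧ ∃ k < n, q.1 = x - k • S.coroot i := by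
  rw [blSum, Finsupp.finsetSum_apply] at h
  obtain ⟨k, hk, h1⟩ := Finset.exists_ne_zero_of_sum_ne_zero h
  rw [Finsupp.smul_apply, smul_eq_mul] at h1
  have h2 := eq_of_ZH_apply_ne_zero (right_ne_zero_of_mul h1)
  exact ⟨by rw [h2], k, Finset.mem_range.1 hk, by rw [h2]⟩

theorem bl4_apply_ne_zero {i : I} {x : Y} {w : S.W} {q : Y × S.W} (h : bl4 P i x w q ≠ 0) :
    q.2 = w ∧ ∃ k ∈ Set.uIcc 0 (S.root i x), q.1 = x - k • S.coroot i := by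
  rw [bl4] at h
  split_ifs at h with h0
  · obtain ⟨h1, k, hk, h2⟩ := blSum_apply_ne_zero P h
    refine ⟨h1, k, Set.mem_uIcc.2 (Or.inl ⟨by omega, by omega⟩), ?_⟩
    rw [h2, natCast_zsmul]
  · rw [Finsupp.neg_apply, neg_ne_zero] at h
    obtain ⟨h1, k, hk, h2⟩ := blSum_apply_ne_zero P h
    -- In this case the sum starts at `r_i(x) = x - α_i(x) α_i^∨`, whence the shift by `α_i(x)`.
    refine ⟨h1, S.root i x + k, Set.mem_uIcc.2 (Or.inr ⟨by omega, by omega⟩), ?_⟩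
    rw [h2, refl_apply, add_smul, natCast_zsmul]
    abel

/-- All control of supports rests on this: the lattice part never leaves the coroot string from `x`
to `r_i(x)`, ends included. -/
theorem leftH_apply_ne_zero {i : I} {x : Y} {w : S.W} {q : Y × S.W}
    (h : leftH P i (S.ZH R x w) q ≠ 0) :
    (q.2 = w ∨ q.2 = S.s i * w) ∧ ∃ k ∈ Set.uIcc 0 (S.root i x), q.1 = x - k • S.coroot i := by
  rw [leftH_ZH, Finsupp.add_apply] at h
  by_cases h2 : bl2 P i (S.refl i x) w q = 0
  · rw [h2, zero_add] at h
    obtain ⟨h3, h4⟩ := bl4_apply_ne_zero P h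
    exact ⟨Or.inl h3, h4⟩
  · rcases bl2_apply_ne_zero P h2 with rfl | rfl
    · exact ⟨Or.inr rfl, _, Set.right_mem_uIcc, refl_apply i x⟩
    · exact ⟨Or.inl rfl, _, Set.right_mem_uIcc, refl_apply i x⟩

theorem leftWord_nil : leftWord P ([] : List I) = LinearMap.id := rfl

theorem leftWord_cons (i : I) (l : List I) (a : S.BL R) :
    leftWord P (i :: l) a = leftH P i (leftWord P l a) := by
  simp [leftWord]

theorem blMul_ZH (x : Y) (w : S.W) (a : S.BL R) :
    blMul P (S.ZH R x w) a = S.leftZ R x (leftWord P (S.reducedWord w) a) := by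
  simp [blMul, ZH]

theorem blMul_ZH_apply (x : Y) (w : S.W) (a : S.BL R) (q : Y × S.W) :
    blMul P (S.ZH R x w) a q = leftWord P (S.reducedWord w) a (q.1 - x, q.2) := by
  rw [blMul_ZH, leftZ_apply]

theorem leftWord_cons_apply_ne_zero {i : I} {l : List I} {a : S.BL R} {q : Y × S.W}
    (h : leftWord P (i :: l) a q ≠ 0) :
    ∃ p, leftWord P l a p ≠ 0 ∧ leftH P i (S.ZH R p.1 p.2) q ≠ 0 := by
  rw [leftWord_cons] at h
  exact exists_of_apply_ne_zero _ h

/-- The set `F` has to be independent of `x`, because `x` runs through infinite supports in a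
convolution. -/
theorem finite_range_leftWord (l : List I) (w : S.W) :
    ∃ F : Set S.W, F.Finite ∧ ∀ x q, leftWord P l (S.ZH R x w) q ≠ 0 → q.2 ∈ F := by
  induction l with
  | nil =>
    refine ⟨{w}, Set.finite_singleton w, fun x q hq => ?_⟩
    rw [eq_of_ZH_apply_ne_zero hq]
    rfl
  | cons i l ih =>
    obtain ⟨F, hF, h⟩ := ih
    refine ⟨F ∪ (S.s i * ·) '' F, hF.union (hF.image _), fun x q hq => ?_⟩
    obtain ⟨p, hp, h1⟩ := leftWord_cons_apply_ne_zero P hq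
    rcases (leftH_apply_ne_zero P h1).1 with h2 | h2
    · exact Or.inl (h2 ▸ h x p hp)
    · exact Or.inr ⟨p.2, h x p hp, h2.symm⟩

variable [Fintype I] {J : Finset Y}

theorem OrbitBounded.leftH {i : I} {x : Y} {w : S.W} {q : Y × S.W} (hx : S.OrbitBounded J x)
    (h : leftH P i (S.ZH R x w) q ≠ 0) : S.OrbitBounded J q.1 := by
  obtain ⟨_, k, hk, e⟩ := leftH_apply_ne_zero P h
  rw [e]
  exact hx.string hk

theorem OrbitBounded.leftWord {l : List I} {x : Y} {w : S.W} {q : Y × S.W}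
    (hx : S.OrbitBounded J x) (h : leftWord P l (S.ZH R x w) q ≠ 0) : S.OrbitBounded J q.1 := by
  induction l generalizing q with
  | nil =>
    rw [eq_of_ZH_apply_ne_zero h]
    exact hx
  | cons i l ih =>
    obtain ⟨p, hp, h1⟩ := leftWord_cons_apply_ne_zero P h
    exact (ih hp).leftH P h1

theorem finite_preimage_leftH (J : Finset Y) (i : I) (q : Y × S.W) :
    {p : Y × S.W | S.OrbitBounded J p.1 ∧ leftH P i (S.ZH R p.1 p.2) q ≠ 0}.Finite := by
  refine ((finite_orbitBounded_string (S := S) J i q.1).prod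
    (Set.toFinite {q.2, S.s i * q.2})).subset ?_
  rintro p ⟨hp, h⟩
  obtain ⟨h1, k, _, h2⟩ := leftH_apply_ne_zero P h
  refine ⟨⟨hp, k, h2⟩, ?_⟩
  rcases h1 with h1 | h1
  · exact Or.inl h1.symm
  · right
    rw [h1, ← mul_assoc, S.s_mul_self, one_mul]
    rfl

/-- Without the orbit bound, infinitely many points of a string could contribute to `q`. The bound
survives each factor, so finiteness propagates along the word. -/
theorem finite_preimage_leftWord (J : Finset Y) (l : List I) (q : Y × S.W) :
    {p : Y × S.W | S.OrbitBounded J p.1 ∧ leftWord P l (S.ZH R p.1 p.2) q ≠ 0}.Finite := by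
  induction l generalizing q with
  | nil =>
    refine (Set.finite_singleton q).subset ?_
    rintro p ⟨_, h⟩
    exact (eq_of_ZH_apply_ne_zero h).symm
  | cons i l ih =>
    refine ((finite_preimage_leftH P J i q).biUnion fun p _ => ih p).subset ?_
    rintro p ⟨hp, h⟩
    obtain ⟨p', hp', h1⟩ := leftWord_cons_apply_ne_zero P h
    exact Set.mem_biUnion ⟨hp.leftWord P hp', h1⟩ (And.intro hp hp')

/-- The convolution `a * b` is defined if `b` is bounded along with its orbits. -/
theorem convDefined_of_orbitBounded {a b : Y × S.W → R} (ha : a ∈ S.completedHecke R)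
    (hb : ∀ p, b p ≠ 0 → S.OrbitBounded J p.1) : P.ConvDefined a b := by
  intro q
  obtain ⟨_, hfin, haf⟩ := ha
  -- The difference `q.1 - x` is the lattice part of a term of `H_w * Z^{x'} H_{w'}`, hence
  -- orbit-bounded by `J`. This leaves finitely many `x`, and then finitely many `(x', w')`.
  refine (hfin.biUnion fun w _ => ((haf w).finite_sub (OrbitBounded.almostFinite S J) q.1).biUnion
    fun x _ => (Set.finite_singleton (x, w)).prod
      (finite_preimage_leftWord P J (S.reducedWord w) (q.1 - x, q.2))).subset ?_
  rintro ⟨⟨x, w⟩, p⟩ h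
  rw [Set.mem_ofPred_eq, convTerm, blMul_ZH_apply] at h
  have ha0 := left_ne_zero_of_mul (left_ne_zero_of_mul h)
  have hb0 := hb _ (right_ne_zero_of_mul (left_ne_zero_of_mul h))
  have h1 := right_ne_zero_of_mul h
  exact Set.mem_biUnion ⟨x, ha0⟩ (Set.mem_biUnion ⟨ha0, hb0.leftWord P h1⟩
    ⟨rfl, hb0, h1⟩)

end Supports

/-! ### Invariant series commute with the Hecke generators. -/

section BernsteinLusztig

variable {I Y R : Type*} [AddCommGroup Y] [CommRing R]
  {S : RootGeneratingSystem I Y} (P : S.Parameters R)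

theorem leftZ_leftZ (x y : Y) (a : S.BL R) :
    S.leftZ R x (S.leftZ R y a) = S.leftZ R (x + y) a := by
  ext q
  rw [leftZ_apply, leftZ_apply, leftZ_apply, sub_sub, add_comm x y, add_comm y x]

theorem leftZ_comm (x y : Y) (a : S.BL R) :
    S.leftZ R x (S.leftZ R y a) = S.leftZ R y (S.leftZ R x a) := by
  rw [leftZ_leftZ, leftZ_leftZ, add_comm]

theorem neg_two_smul_coroot_ne_zero (i : I) : -(2 • S.coroot i) ≠ 0 := by
  intro h
  rw [neg_eq_zero] at h
  have h3 := congrArg (S.root i) h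
  rw [map_nsmul, S.root_coroot_self, map_zero] at h3
  norm_num at h3

theorem bl4_eq_zero {i : I} {x : Y} (h : S.root i x = 0) (w : S.W) : bl4 P i x w = 0 := by
  simp [bl4, h, blSum]

theorem leftZ_bl2 (i : I) (x y : Y) (w : S.W) :
    S.leftZ R x (bl2 P i y w) = bl2 P i (x + y) w := by
  rw [bl2, bl2]
  split_ifs <;> simp only [map_add, map_smul, leftZ_ZH]

theorem finite_leftZ (a : S.BL R) (q : Y × S.W) : {x | S.leftZ R x a q ≠ 0}.Finite := by
  refine (a.support.finite_toSet.image fun p => q.1 - p.1).subset fun x hx => ?_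
  rw [Set.mem_ofPred_eq, leftZ_apply] at hx
  exact ⟨_, Finsupp.mem_support_iff.2 hx, by simp⟩

theorem finite_leftH_leftZ [Fintype I] {J : Finset Y} {z : Y → R} (i : I)
    (hJ : ∀ x, z x ≠ 0 → S.OrbitBounded J x) (a : S.BL R) (q : Y × S.W) :
    (Function.support fun x => z x * leftH P i (S.leftZ R x a) q).Finite := by
  refine (a.support.finite_toSet.biUnion fun p _ =>
    finite_orbitBounded_string (S := S) J i (q.1 - p.1)).subset fun x hx => ?_
  have h1 := right_ne_zero_of_mul hx
  obtain ⟨p, hp, h2⟩ := exists_of_apply_ne_zero _ h1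
  rw [leftZ_apply] at hp
  obtain ⟨_, k, _, hk⟩ := leftH_apply_ne_zero P h2
  refine Set.mem_biUnion (Finsupp.mem_support_iff.2 hp) ⟨hJ x (left_ne_zero_of_mul hx), k, ?_⟩
  rw [hk]
  dsimp only
  abel

variable [Module.Free ℤ Y]

/-- Allows identities on `bl4` to be checked after multiplication by the denominator `1 - Z^{-2
α_i^∨}`. -/
theorem eq_of_sub_leftZ_eq {y : Y} (hy : y ≠ 0) {a b : S.BL R}
    (h : a - S.leftZ R y a = b - S.leftZ R y b) : a = b := by
  refine sub_eq_zero.1 (eq_zero_of_leftZ_eq hy ?_)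
  rw [map_sub]
  rw [sub_eq_sub_iff_add_eq_add] at h ⊢
  rw [add_comm, ← h, add_comm]

/-- The numerator `Z^x - Z^{r_i(x)}` changes sign; this antisymmetry is the source of the centrality
of invariant series. -/
theorem bl4_refl (i : I) (x : Y) (w : S.W) : bl4 P i (S.refl i x) w = -bl4 P i x w := by
  refine eq_of_sub_leftZ_eq (neg_two_smul_coroot_ne_zero (S := S) i) ?_
  have h : -bl4 P i x w - S.leftZ R (-(2 • S.coroot i)) (-bl4 P i x w) =
      -(bl4 P i x w - S.leftZ R (-(2 • S.coroot i)) (bl4 P i x w)) := by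
    rw [map_neg]; abel
  rw [h, bl4_spec, bl4_spec, refl_refl]
  abel

/-- A twisted Leibniz rule, from `Z^{x+y} - Z^{r_i(x+y)} = Z^{r_i(x)} (Z^y - Z^{r_i(y)}) + Z^y (Z^x
- Z^{r_i(x)})`. -/
theorem bl4_add (i : I) (x y : Y) (w : S.W) :
    bl4 P i (x + y) w =
      S.leftZ R (S.refl i x) (bl4 P i y w) + S.leftZ R y (bl4 P i x w) := by
  refine eq_of_sub_leftZ_eq (neg_two_smul_coroot_ne_zero (S := S) i) ?_
  have h : ∀ a b : S.BL R, ∀ x y z : Y,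
      S.leftZ R x a + S.leftZ R y b - S.leftZ R z (S.leftZ R x a + S.leftZ R y b) =
      S.leftZ R x (a - S.leftZ R z a) + S.leftZ R y (b - S.leftZ R z b) := by
    intro a b x y z
    rw [map_add, map_sub, map_sub, leftZ_comm z x, leftZ_comm z y]; abel
  rw [h, bl4_spec, bl4_spec, bl4_spec]
  simp only [map_sub, map_add, map_smul, leftZ_ZH]
  have e1 : S.refl i x + (-S.coroot i + y) = y + (-S.coroot i + S.refl i x) := by abel
  have e2 : S.refl i x + (-S.coroot i + S.refl i y) = -S.coroot i + (S.refl i x + S.refl i y) := by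
    abel
  have e3 : y + (-S.coroot i + x) = -S.coroot i + (x + y) := by abel
  rw [e1, e2, e3, add_comm y x, add_comm y (S.refl i x)]
  abel

/-- The commutation of `H_i` with `Z^x`, applied to `Z^y H_w`. -/
theorem leftH_ZH_add (i : I) (x y : Y) (w : S.W) :
    leftH P i (S.ZH R (x + y) w) =
      S.leftZ R (S.refl i x) (leftH P i (S.ZH R y w)) + S.leftZ R y (bl4 P i x w) := by
  rw [leftH_ZH, leftH_ZH, bl4_add, map_add, map_add, leftZ_bl2]
  abel

variable [Fintype I] {J : Finset Y} {z : Y → R}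

/-- The terms of `x` and `r_i(x)` are opposite. At a fixed point the term itself vanishes, so no
division by 2 is needed. -/
theorem finsum_leftZ_bl4 (i : I) (hz : ∀ x, z (S.refl i x) = z x)
    (hJ : ∀ x, z x ≠ 0 → S.OrbitBounded J x) (y : Y) (w : S.W) (q : Y × S.W) :
    ∑ᶠ x, z x * S.leftZ R y (bl4 P i x w) q = 0 := by
  have hfin : (Function.support fun x => z x * S.leftZ R y (bl4 P i x w) q).Finite := by
    refine (finite_orbitBounded_string (S := S) J i (q.1 - y)).subset fun x hx => ?_
    have h1 := right_ne_zero_of_mul hx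
    rw [leftZ_apply] at h1
    obtain ⟨_, k, _, hk⟩ := bl4_apply_ne_zero P h1
    exact ⟨hJ x (left_ne_zero_of_mul hx), k, hk⟩
  have hneg : ∀ x, z (S.refl i x) * S.leftZ R y (bl4 P i (S.refl i x) w) q =
      -(z x * S.leftZ R y (bl4 P i x w) q) := fun x => by
    rw [bl4_refl, hz, map_neg, Finsupp.neg_apply, mul_neg]
  rw [finsum_eq_sum _ hfin]
  refine Finset.sum_involution (fun x _ => S.refl i x) ?_ ?_ ?_ ?_
  · intro x _
    rw [hneg, add_neg_cancel]
  · intro x _ hx h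
    apply hx
    have h0 := congrArg (S.root i) h
    rw [root_refl_self] at h0
    rw [bl4_eq_zero P (by omega), map_zero, Finsupp.zero_apply, mul_zero]
  · intro x hx
    rw [Set.Finite.mem_toFinset, Function.mem_support] at hx ⊢
    rw [hneg]
    exact neg_ne_zero.2 hx
  · intro x _
    exact refl_refl i x

/-- An invariant series commutes with `H_i`, applied to an element of `^{BL}H`. -/
theorem finsum_leftH (i : I) (hz : ∀ x, z (S.refl i x) = z x)
    (hJ : ∀ x, z x ≠ 0 → S.OrbitBounded J x) (a : S.BL R) (q : Y × S.W) :
    ∑ᶠ x, z x * leftH P i (S.leftZ R x a) q = ∑ᶠ x, z x * S.leftZ R x (leftH P i a) q := by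
  have hfin : ∀ a : S.BL R, (Function.support fun x => z x * S.leftZ R x a q).Finite := fun a =>
    (finite_leftZ a q).subset fun x hx => right_ne_zero_of_mul hx
  induction a using Finsupp.induction_linear with
  | zero => simp
  | add a b iha ihb =>
    simp only [map_add, Finsupp.add_apply, mul_add]
    rw [finsum_add_distrib (finite_leftH_leftZ P i hJ a q) (finite_leftH_leftZ P i hJ b q),
      finsum_add_distrib (hfin _) (hfin _), iha, ihb]
  | single p r =>
    have hp : Finsupp.single p r = r • S.ZH R p.1 p.2 := by simp [ZH]
    simp only [hp, map_smul, Finsupp.smul_apply, smul_eq_mul, mul_left_comm _ r]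
    -- The second part sums to zero by antisymmetry; the first becomes the right-hand side on
    -- substituting `r_i(x)` for `x`.
    have h1 : ∀ x, z x * leftH P i (S.leftZ R x (S.ZH R p.1 p.2)) q =
        z x * S.leftZ R (S.refl i x) (leftH P i (S.ZH R p.1 p.2)) q +
          z x * S.leftZ R p.1 (bl4 P i x p.2) q := fun x => by
      rw [leftZ_ZH, leftH_ZH_add, Finsupp.add_apply, mul_add]
    have h2 : ∑ᶠ x, z x * S.leftZ R (S.refl i x) (leftH P i (S.ZH R p.1 p.2)) q =
        ∑ᶠ x, z x * S.leftZ R x (leftH P i (S.ZH R p.1 p.2)) q := by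
      rw [← finsum_comp_equiv (S.refl i).toEquiv]
      refine finsum_congr fun x => ?_
      simp [hz]
    have h3 : (Function.support fun x =>
        z x * S.leftZ R (S.refl i x) (leftH P i (S.ZH R p.1 p.2)) q).Finite := by
      refine ((finite_leftZ (leftH P i (S.ZH R p.1 p.2)) q).preimage
        (S.refl i).injective.injOn).subset fun x hx => right_ne_zero_of_mul hx
    have h4 : (Function.support fun x => z x * S.leftZ R p.1 (bl4 P i x p.2) q).Finite := by
      refine ((finite_leftH_leftZ P i hJ (S.ZH R p.1 p.2) q).union h3).subset fun x hx => ?_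
      by_contra hcon
      simp only [Set.mem_union, Function.mem_support, not_or, not_not] at hcon
      have h5 := h1 x
      rw [hcon.1, hcon.2, zero_add] at h5
      exact hx h5.symm
    rw [← mul_finsum' _ _ (finite_leftH_leftZ P i hJ (S.ZH R p.1 p.2) q),
      ← mul_finsum' _ _ (hfin _), finsum_congr h1, finsum_add_distrib h3 h4,
      finsum_leftZ_bl4 P i hz hJ, add_zero, h2]

/-- An invariant series commutes with products of the `H_i`. -/
theorem finsum_leftWord (hz : ∀ i x, z (S.refl i x) = z x)
    (hJ : ∀ x, z x ≠ 0 → S.OrbitBounded J x) (l : List I) (w : S.W) (q : Y × S.W) :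
    ∑ᶠ x, z x * leftWord P l (S.ZH R x w) q =
      ∑ᶠ x, z x * S.leftZ R x (leftWord P l (S.ZH R 0 w)) q := by
  induction l generalizing q with
  | nil =>
    refine finsum_congr fun x => ?_
    rw [leftWord_nil, LinearMap.id_apply, LinearMap.id_apply, leftZ_ZH, add_zero]
  | cons i l ih =>
    simp only [leftWord_cons]
    rw [← finsum_leftH P i (hz i) hJ]
    -- On vectors with support orbit-bounded by `J`, the coefficient of `H_i * a` at `q` depends
    -- only on the coordinates in the finite set `F`, so `H_i` may be exchanged with the infinite
    -- sum.
    set F := (finite_preimage_leftH P J i q).toFinset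
    have hexp : ∀ a : S.BL R, (∀ p, a p ≠ 0 → S.OrbitBounded J p.1) →
        leftH P i a q = ∑ p ∈ F, a p * leftH P i (S.ZH R p.1 p.2) q := by
      intro a ha
      rw [apply_eq_sum, Finsupp.sum]
      refine Finset.sum_congr_of_eq_on_inter ?_ ?_ fun _ _ _ => rfl
      · intro p hp hpF
        by_contra hne
        exact hpF ((Set.Finite.mem_toFinset _).2
          ⟨ha p (left_ne_zero_of_mul hne), right_ne_zero_of_mul hne⟩)
      · intro p _ hp
        rw [Finsupp.notMem_support_iff.1 hp, zero_mul]
    have hswap : ∀ X : Y → S.BL R, (∀ x, z x ≠ 0 → ∀ p, X x p ≠ 0 → S.OrbitBounded J p.1) →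
        (∀ p, (Function.support fun x => z x * X x p).Finite) →
        ∑ᶠ x, z x * leftH P i (X x) q =
          ∑ p ∈ F, (∑ᶠ x, z x * X x p) * leftH P i (S.ZH R p.1 p.2) q := by
      intro X hX hfin
      have h1 : ∀ x, z x * leftH P i (X x) q =
          ∑ p ∈ F, z x * X x p * leftH P i (S.ZH R p.1 p.2) q := by
        intro x
        by_cases hx : z x = 0
        · simp [hx]
        · rw [hexp _ (hX x hx), Finset.mul_sum]
          exact Finset.sum_congr rfl fun p _ => (mul_assoc _ _ _).symm
      rw [finsum_congr h1, finsum_sum_comm]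
      · exact Finset.sum_congr rfl fun p _ => (finsum_mul' _ _ (hfin p)).symm
      · exact fun p _ => (hfin p).subset fun x hx => left_ne_zero_of_mul hx
    rw [hswap (fun x => leftWord P l (S.ZH R x w)), hswap (fun x =>
      S.leftZ R x (leftWord P l (S.ZH R 0 w)))]
    · exact Finset.sum_congr rfl fun p _ => by rw [ih]
    · intro x hx p hp
      rw [leftZ_apply] at hp
      have h1 := (hJ x hx).add_of_zero ((orbitBounded_zero (S := S)).leftWord P hp)
      simpa using h1
    · exact fun p => (finite_leftZ _ p).subset fun x hx => right_ne_zero_of_mul hx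
    · exact fun x hx p hp => (hJ x hx).leftWord P hp
    · intro p
      refine ((finite_preimage_leftWord P J l p).preimage
        (f := fun x => (x, w)) (fun a _ b _ h => congrArg Prod.fst h)).subset fun x hx => ?_
      exact ⟨hJ x (left_ne_zero_of_mul hx), right_ne_zero_of_mul hx⟩

end BernsteinLusztig

theorem finsum_eq_finsum_comp {α β M : Type*} [AddCommMonoid M] {f : α → M} {g : β → α}
    (hg : Function.Injective g) (hf : ∀ x, f x ≠ 0 → x ∈ Set.range g) :
    ∑ᶠ x, f x = ∑ᶠ y, f (g y) := by
  classical
  rw [← finsum_mem_range hg]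
  refine finsum_congr fun x => ?_
  by_cases hx : x ∈ Set.range g
  · rw [finsum_eq_if, if_pos hx]
  · rw [finsum_eq_if, if_neg hx]
    by_contra h
    exact hx (hf x h)

/-! ### Lengths and leading coefficients. -/

section Length

variable {I Y R : Type*} [AddCommGroup Y] [CommRing R] {S : RootGeneratingSystem I Y}
  (P : S.Parameters R)

theorem length_one : S.length 1 = 0 := Nat.le_zero.1 (length_le (S := S) [])

theorem eq_one_of_length_eq_zero {w : S.W} (h : S.length w = 0) : w = 1 := by
  obtain ⟨l, hl, rfl⟩ := S.exists_reduced w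
  rw [h, List.length_eq_zero_iff] at hl
  rw [hl]
  rfl

theorem length_reducedWord (w : S.W) : (S.reducedWord w).length = S.length w :=
  (S.exists_reduced w).choose_spec.1

theorem wordProd_reducedWord (w : S.W) : S.wordProd (S.reducedWord w) = w :=
  (S.exists_reduced w).choose_spec.2

theorem reducedWord_one : S.reducedWord 1 = [] := by
  rw [← List.length_eq_zero_iff, length_reducedWord, length_one]

theorem length_le_length_s_mul (i : I) (w : S.W) : S.length w ≤ S.length (S.s i * w) + 1 := by
  have h := length_s_mul_le i (S.s i * w)
  rwa [← mul_assoc, S.s_mul_self, one_mul] at h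

theorem blMul_ZH_one (x : Y) (a : S.BL R) : blMul P (S.ZH R x 1) a = S.leftZ R x a := by
  rw [blMul_ZH, reducedWord_one, leftWord_nil, LinearMap.id_apply]

theorem leftWord_ZH_zero_one (l : List I) (hl : l.length = S.length (S.wordProd l)) :
    leftWord P l (S.ZH R 0 1) = S.ZH R 0 (S.wordProd l) := by
  induction l with
  | nil => rfl
  | cons i l ih =>
    rw [wordProd_cons, List.length_cons] at hl
    have h1 := length_s_mul_le i (S.wordProd l)
    have h2 := length_le (S := S) l
    rw [leftWord_cons, ih (by omega), leftH_ZH, bl4_eq_zero P (map_zero _), map_zero, add_zero, bl2,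
      if_pos (by omega), wordProd_cons]

theorem leftWord_reducedWord (w : S.W) :
    leftWord P (S.reducedWord w) (S.ZH R 0 1) = S.ZH R 0 w := by
  rw [leftWord_ZH_zero_one P _ (by rw [length_reducedWord, wordProd_reducedWord]),
    wordProd_reducedWord]

theorem length_le_of_leftWord_apply_ne_zero {l : List I} {x : Y} {q : Y × S.W}
    (h : leftWord P l (S.ZH R x 1) q ≠ 0) : S.length q.2 ≤ l.length := by
  induction l generalizing q with
  | nil =>
    rw [eq_of_ZH_apply_ne_zero h, length_one]
    exact Nat.zero_le _
  | cons i l ih =>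
    obtain ⟨p, hp, h1⟩ := leftWord_cons_apply_ne_zero P h
    have h2 := ih hp
    have h3 := length_s_mul_le i p.2
    rw [List.length_cons]
    rcases (leftH_apply_ne_zero P h1).1 with h4 | h4 <;> rw [h4] <;> omega

open Classical in
-- Every term of `H_i * Z^x H_v` other than `Z^{r_i(x)} H_{r_i v}` has Weyl component `v`, which is
-- too short to be `w`.
theorem leftH_ZH_apply_of_length_lt {i : I} {x y : Y} {v w : S.W} (h : S.length v < S.length w) :
    leftH P i (S.ZH R x v) (y, w) = if (x, v) = (S.refl i y, S.s i * w) then 1 else 0 := by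
  have hvw : v ≠ w := fun e => by rw [e] at h; omega
  have h4 : bl4 P i x v (y, w) = 0 := by
    by_contra hne
    exact hvw (bl4_apply_ne_zero P hne).1.symm
  have h0 : S.ZH R (S.refl i x) v (y, w) = 0 := by
    by_contra hne
    exact hvw (congrArg Prod.snd (eq_of_ZH_apply_ne_zero hne)).symm
  have h2 : bl2 P i (S.refl i x) v (y, w) = S.ZH R (S.refl i x) (S.s i * v) (y, w) := by
    rw [bl2]
    split_ifs
    · rfl
    · rw [Finsupp.add_apply, Finsupp.smul_apply, h0, smul_zero, zero_add]
  rw [leftH_ZH, Finsupp.add_apply, h2, h4, add_zero, ZH_apply]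
  refine if_congr ?_ rfl rfl
  simp only [Prod.mk.injEq]
  constructor
  · rintro ⟨rfl, rfl⟩
    exact ⟨(refl_refl i x).symm, by rw [← mul_assoc, S.s_mul_self, one_mul]⟩
  · rintro ⟨rfl, rfl⟩
    exact ⟨refl_refl i y, by rw [← mul_assoc, S.s_mul_self, one_mul]⟩

theorem leftH_apply_of_length_lt {i : I} {y : Y} {w : S.W} {a : S.BL R}
    (h : ∀ p, a p ≠ 0 → S.length p.2 < S.length w) :
    leftH P i a (y, w) = a (S.refl i y, S.s i * w) := by
  classical
  rw [apply_eq_sum, Finsupp.sum]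
  have h1 : ∀ p ∈ a.support, a p * leftH P i (S.ZH R p.1 p.2) (y, w) =
      if p = (S.refl i y, S.s i * w) then a p else 0 := by
    intro p hp
    rw [leftH_ZH_apply_of_length_lt P (h p (Finsupp.mem_support_iff.1 hp)), mul_ite, mul_one,
      mul_zero]
  rw [Finset.sum_congr rfl h1, Finset.sum_ite_eq']
  split_ifs with h2
  · rfl
  · exact (Finsupp.notMem_support_iff.1 h2).symm

/-- The leading coefficient of `H_{i_1} * ⋯ * H_{i_k} * Z^x`. -/
theorem leftWord_apply_of_length_le {l : List I} {x y : Y} {w : S.W}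
    (h : l.length ≤ S.length w) :
    leftWord P l (S.ZH R x 1) (y, w) =
      S.ZH R ((S.wordProd l : Y ≃ₗ[ℤ] Y) x) (S.wordProd l) (y, w) := by
  induction l generalizing y w with
  | nil => rfl
  | cons i l ih =>
    rw [List.length_cons] at h
    have h1 := length_le_length_s_mul i w
    rw [leftWord_cons, leftH_apply_of_length_lt P, ih (by omega), wordProd_cons, coe_s_mul_apply]
    · classical
      rw [ZH_apply, ZH_apply]
      refine if_congr ?_ rfl rfl
      simp only [Prod.mk.injEq]
      constructor
      · rintro ⟨h1, h2⟩
        exact ⟨by rw [h1, refl_refl], by rw [h2, ← mul_assoc, S.s_mul_self, one_mul]⟩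
      · rintro ⟨h1, h2⟩
        exact ⟨by rw [← h1, refl_refl], by rw [← h2, ← mul_assoc, S.s_mul_self, one_mul]⟩
    · intro p hp
      have := length_le_of_leftWord_apply_ne_zero P hp
      omega

end Length

/-! ### Lines in almost finite sets, regular elements and faithfulness. -/

section Regular

variable {I Y : Type*} [Fintype I] [AddCommGroup Y] {S : RootGeneratingSystem I Y}

/-- An almost finite set does not contain a line in a direction of the coroot lattice. -/
theorem AlmostFinite.eq_zero_of_line {E : Set Y} (hE : S.AlmostFinite E) {x : Y} {m : I → ℤ}
    (h : ∀ n : ℤ, x + n • S.corootComb m ∈ E) : m = 0 := by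
  obtain ⟨J, hJ⟩ := hE
  obtain ⟨z, hz⟩ := exists_coset_bound (S := S) J x
  have h1 : ∀ n : ℤ, S.leQ (x + n • S.corootComb m) z := by
    intro n
    obtain ⟨y, hy, hxy⟩ := hJ _ (h n)
    refine leQ_trans hxy (hz y hy ?_)
    obtain ⟨m', _, hm'⟩ := leQ_iff.1 hxy
    exact ⟨m' + n • m, by rw [map_add, map_smul, ← hm']; abel⟩
  obtain ⟨c, hc, ec⟩ := leQ_iff.1 (h1 0)
  ext i
  by_contra hi
  rw [Pi.zero_apply] at hi
  -- This multiple lowers the `i`-th coefficient of the gap to `z` from `c i` by `(c i + 1) * (m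
  -- i)²`, which makes it negative.
  obtain ⟨d, hd, ed⟩ := leQ_iff.1 (h1 ((c i + 1) * m i))
  have e : c = d + ((c i + 1) * m i) • m := corootComb_injective (S := S) (by
    rw [map_add, map_smul, ← ec, ← ed, zero_smul]; abel)
  have e1 := congrFun e i
  have h2 := hd i
  have h3 := hc i
  have h4 : 0 < m i * m i := mul_self_pos.2 hi
  simp only [Pi.add_apply, Pi.smul_apply, smul_eq_mul, Pi.zero_apply] at e1 h2 h3
  nlinarith

variable [Module.Free ℤ Y] [Module.Finite ℤ Y]

variable (S) in
/-- There are regular dominant elements. -/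
theorem exists_regular : ∃ x : Y, ∀ i, 0 < S.root i x := by
  classical
  let b := Module.Free.chooseBasis ℤ Y
  let M : Matrix I (Module.Free.ChooseBasisIndex ℤ Y) ℤ := Matrix.of fun i k => S.root i (b k)
  -- The Gram matrix of linearly independent rows is nonsingular: a kernel vector `v` would have `Mᵀ
  -- v` of norm zero.
  have hdet : (M * M.transpose).det ≠ 0 := by
    intro h
    obtain ⟨v, hv, h0⟩ := Matrix.exists_mulVec_eq_zero_iff.2 h
    apply hv
    have h1 : M.transpose.mulVec v = 0 := by
      have h2 : v ⬝ᵥ ((M * M.transpose).mulVec v) = 0 := by rw [h0, dotProduct_zero]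
      rw [← Matrix.mulVec_mulVec, Matrix.dotProduct_mulVec, ← Matrix.mulVec_transpose] at h2
      exact dotProduct_self_eq_zero.1 h2
    refine funext (Fintype.linearIndependent_iff.1 S.root_free v (b.ext fun k => ?_))
    have h3 := congrFun h1 k
    simpa [M, Matrix.mulVec, dotProduct, mul_comm] using h3
  set G := M * M.transpose with hG
  -- The adjugate replaces the inverse over `ℤ`; the extra factor `G.det` makes all entries of `G c`
  -- equal to the positive square of the determinant.
  let c : I → ℤ := G.adjugate.mulVec fun _ => G.det
  refine ⟨∑ k, (M.transpose.mulVec c) k • b k, fun i => ?_⟩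
  have h1 : S.root i (∑ k, (M.transpose.mulVec c) k • b k) = (G.mulVec c) i := by
    rw [hG, ← Matrix.mulVec_mulVec, map_sum]
    simp only [map_smul, smul_eq_mul]
    rw [Matrix.mulVec, dotProduct]
    exact Finset.sum_congr rfl fun k _ => mul_comm _ _
  have h2 : G.mulVec c = fun _ => G.det * G.det := by
    rw [Matrix.mulVec_mulVec, Matrix.mul_adjugate, Matrix.smul_mulVec, Matrix.one_mulVec]
    rfl
  rw [h1, h2]
  exact mul_self_pos.2 hdet

/-- An element of `W^v` that fixes the Tits cone is trivial. -/
theorem eq_one_of_forall_Yplus {w : S.W} (h : ∀ x ∈ S.Yplus, (w : Y ≃ₗ[ℤ] Y) x = x) : w = 1 := by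
  obtain ⟨ρ, hρ⟩ := S.exists_regular
  have hdom : ∀ x, (∀ i, 0 ≤ S.root i x) → (w : Y ≃ₗ[ℤ] Y) x = x := fun x hx => h x ⟨1, hx⟩
  apply Subtype.ext
  ext y
  have h1 := hdom ρ fun i => (hρ i).le
  -- A large multiple of the regular element `ρ` makes any `y` dominant, so an element fixing the
  -- dominant cone fixes `y`.
  have h2 := hdom (y + (∑ i, |S.root i y|) • ρ) fun i => by
    rw [map_add, map_smul, smul_eq_mul]
    have h3 : |S.root i y| ≤ ∑ i, |S.root i y| :=
      Finset.single_le_sum (f := fun i => |S.root i y|) (fun _ _ => abs_nonneg _)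
        (Finset.mem_univ i)
    have h4 := neg_abs_le (S.root i y)
    have h5 := hρ i
    have h6 := abs_nonneg (S.root i y)
    nlinarith
  rw [map_add, map_smul, h1, add_left_inj] at h2
  exact h2

end Regular

/-! ### The center of the completed Hecke algebra. -/

section Center

variable {I Y R : Type*} [AddCommGroup Y] [CommRing R]
  {S : RootGeneratingSystem I Y} (P : S.Parameters R)

theorem ofLooijenga_apply_one (a : Y → R) (x : Y) : S.ofLooijenga a (x, 1) = a x :=
  if_pos rfl

theorem snd_eq_one_of_ofLooijenga_ne_zero {a : Y → R} {p : Y × S.W}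
    (h : S.ofLooijenga a p ≠ 0) : p.2 = 1 := by
  by_contra hp
  exact h (if_neg hp)

theorem ofLooijenga_ne_zero {a : Y → R} {p : Y × S.W} (h : S.ofLooijenga a p ≠ 0) :
    a p.1 ≠ 0 := by
  obtain ⟨x, w⟩ := p
  obtain rfl : w = 1 := snd_eq_one_of_ofLooijenga_ne_zero h
  rwa [ofLooijenga_apply_one] at h

theorem convTerm_ofLooijenga_ne_zero {z : Y → R} {a : Y × S.W → R} {q : Y × S.W}
    {p : (Y × S.W) × (Y × S.W)} (h : convTerm P (S.ofLooijenga z) a q p ≠ 0) :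
    p = ((p.1.1, 1), (q.1 - p.1.1, q.2)) ∧ z p.1.1 ≠ 0 ∧ a (q.1 - p.1.1, q.2) ≠ 0 := by
  obtain ⟨⟨x, w⟩, p⟩ := p
  have h0 := left_ne_zero_of_mul (left_ne_zero_of_mul h)
  have h1 := right_ne_zero_of_mul (left_ne_zero_of_mul h)
  have h2 := right_ne_zero_of_mul h
  obtain rfl : w = 1 := snd_eq_one_of_ofLooijenga_ne_zero h0
  dsimp only at h2 ⊢
  rw [blMul_ZH_one, leftZ_ZH] at h2
  have h3 := eq_of_ZH_apply_ne_zero h2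
  have h4 : p = (q.1 - x, q.2) := by rw [h3]; simp
  rw [← h4]
  exact ⟨rfl, ofLooijenga_ne_zero h0, h1⟩

theorem conv_ZH_right (z : Y × S.W → R) (x : Y) (w : S.W) (q : Y × S.W) :
    P.conv z (S.ZH R x w) q = ∑ᶠ p : Y × S.W, z p * blMul P (S.ZH R p.1 p.2) (S.ZH R x w) q := by
  rw [Parameters.conv, finsum_eq_finsum_comp (g := fun p => (p, (x, w)))
    (fun a b h => congrArg Prod.fst h)]
  · refine finsum_congr fun p => ?_
    rw [convTerm, ZH_apply, if_pos rfl, mul_one]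
  · rintro ⟨p, p'⟩ h
    exact ⟨p, Prod.ext rfl
      (eq_of_ZH_apply_ne_zero (right_ne_zero_of_mul (left_ne_zero_of_mul h))).symm⟩

theorem conv_ZH_left (z : Y × S.W → R) (x : Y) (w : S.W) (q : Y × S.W) :
    P.conv (S.ZH R x w) z q = ∑ᶠ p : Y × S.W, z p * blMul P (S.ZH R x w) (S.ZH R p.1 p.2) q := by
  rw [Parameters.conv, finsum_eq_finsum_comp (g := fun p => ((x, w), p))
    (fun a b h => congrArg Prod.snd h)]
  · refine finsum_congr fun p => ?_
    rw [convTerm, ZH_apply, if_pos rfl, one_mul]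
  · rintro ⟨p, p'⟩ h
    exact ⟨p', Prod.ext
      (eq_of_ZH_apply_ne_zero (left_ne_zero_of_mul (left_ne_zero_of_mul h))).symm rfl⟩

theorem conv_Z_left (z : Y × S.W → R) (x : Y) (q : Y × S.W) :
    P.conv (S.ZH R x 1) z q = z (q.1 - x, q.2) := by
  rw [conv_ZH_left, finsum_eq_single _ (q.1 - x, q.2)]
  · rw [blMul_ZH_one, leftZ_ZH, ZH_apply, if_pos (by simp), mul_one]
  · intro p hp
    by_contra hne
    apply hp
    have h := right_ne_zero_of_mul hne
    rw [blMul_ZH_one, leftZ_ZH] at h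
    rw [eq_of_ZH_apply_ne_zero h]
    simp

/-- A term of `z` with Weyl component `v` reaches length `ℓ(w)` only through the leading term of
`H_v * Z^x`, which forces `v = w`. -/
theorem conv_Z_right_of_maximal (z : Y × S.W → R) (x y : Y) (w : S.W)
    (hw : ∀ p, z p ≠ 0 → S.length p.2 ≤ S.length w) :
    P.conv z (S.ZH R x 1) (y, w) = z (y - (w : Y ≃ₗ[ℤ] Y) x, w) := by
  have h0 : ∀ p : Y × S.W, z p ≠ 0 → blMul P (S.ZH R p.1 p.2) (S.ZH R x 1) (y, w) =
      S.ZH R ((p.2 : Y ≃ₗ[ℤ] Y) x) p.2 (y - p.1, w) := by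
    intro p hp
    rw [blMul_ZH_apply, leftWord_apply_of_length_le P (by
      rw [length_reducedWord]; exact hw p hp), wordProd_reducedWord]
  rw [conv_ZH_right, finsum_eq_single _ (y - (w : Y ≃ₗ[ℤ] Y) x, w)]
  · by_cases hz : z (y - (w : Y ≃ₗ[ℤ] Y) x, w) = 0
    · rw [hz, zero_mul]
    · rw [h0 _ hz, ZH_apply, if_pos (by simp), mul_one]
  · intro p hp
    by_contra hne
    apply hp
    have h := right_ne_zero_of_mul hne
    rw [h0 p (left_ne_zero_of_mul hne)] at h
    have h1 := eq_of_ZH_apply_ne_zero h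
    simp only [Prod.mk.injEq] at h1
    refine Prod.ext ?_ h1.2.symm
    rw [h1.2, ← h1.1, sub_sub_cancel]

theorem conv_H_right_of_eq_one (z : Y × S.W → R) (y : Y) (w : S.W)
    (hz : ∀ p, z p ≠ 0 → p.2 = 1) : P.conv z (S.ZH R 0 w) (y, w) = z (y, 1) := by
  rw [conv_ZH_right, finsum_eq_single _ (y, 1)]
  · rw [blMul_ZH_one, leftZ_ZH, ZH_apply, if_pos (by simp), mul_one]
  · rintro ⟨x, v⟩ hp
    by_contra hne
    apply hp
    obtain rfl : v = 1 := hz _ (left_ne_zero_of_mul hne)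
    have h := right_ne_zero_of_mul hne
    rw [blMul_ZH_one, leftZ_ZH] at h
    have h1 := eq_of_ZH_apply_ne_zero h
    simp only [add_zero, Prod.mk.injEq, and_true] at h1
    rw [h1]

/-- Only the leading term `Z^{w(x)} H_w` of `H_w * Z^x` has Weyl component `w`. Compared with
`conv_H_right_of_eq_one`, this gives invariance of the coefficients. -/
theorem conv_H_left_of_eq_one (z : Y × S.W → R) (y : Y) (w : S.W)
    (hz : ∀ p, z p ≠ 0 → p.2 = 1) :
    P.conv (S.ZH R 0 w) z (y, w) = z (((w⁻¹ : S.W) : Y ≃ₗ[ℤ] Y) y, 1) := by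
  have h0 : ∀ x, blMul P (S.ZH R 0 w) (S.ZH R x 1) (y, w) =
      S.ZH R ((w : Y ≃ₗ[ℤ] Y) x) w (y, w) := fun x => by
    rw [blMul_ZH_apply, sub_zero, leftWord_apply_of_length_le P (by
      rw [length_reducedWord]), wordProd_reducedWord]
  rw [conv_ZH_left, finsum_eq_single _ (((w⁻¹ : S.W) : Y ≃ₗ[ℤ] Y) y, 1)]
  · rw [h0, coe_apply_inv_apply, ZH_apply, if_pos rfl, mul_one]
  · rintro ⟨x, v⟩ hp
    by_contra hne
    apply hp
    obtain rfl : v = 1 := hz _ (left_ne_zero_of_mul hne)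
    have h := right_ne_zero_of_mul hne
    rw [h0] at h
    have h1 := congrArg Prod.fst (eq_of_ZH_apply_ne_zero h)
    dsimp only at h1
    rw [h1, coe_inv_apply_apply]

theorem zero_mem_Yplus : (0 : Y) ∈ S.Yplus := ⟨1, fun i => by simp⟩

theorem conv_ofLooijenga_ofLooijenga (a b : Y → R) :
    P.conv (S.ofLooijenga a) (S.ofLooijenga b) = S.ofLooijenga (looijengaMul a b) := by
  funext q
  obtain ⟨y, w⟩ := q
  rw [Parameters.conv, finsum_eq_finsum_comp
    (g := fun x => (((x, 1), (y - x, w)) : (Y × S.W) × (Y × S.W)))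
    (fun a b h => congrArg (fun p => p.1.1) h)
    (fun p hp => ⟨p.1.1, (convTerm_ofLooijenga_ne_zero P hp).1.symm⟩)]
  have h1 : ∀ x, convTerm P (S.ofLooijenga a) (S.ofLooijenga b) (y, w) ((x, 1), (y - x, w)) =
      a x * S.ofLooijenga b (y - x, w) := fun x => by
    rw [convTerm, ofLooijenga_apply_one, blMul_ZH_one, leftZ_ZH, ZH_apply, if_pos (by simp),
      mul_one]
  rw [finsum_congr h1]
  by_cases hw : w = 1
  · rw [hw, ofLooijenga_apply_one, looijengaMul]
    exact finsum_congr fun x => by rw [ofLooijenga_apply_one]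
  · rw [ofLooijenga, if_neg hw]
    refine (finsum_congr fun x => ?_).trans finsum_zero
    rw [ofLooijenga, if_neg hw, mul_zero]

variable [Fintype I]

theorem exists_orbitBounded_of_invariant {z : Y → R} (hz : z ∈ S.looijengaInvariants R) :
    ∃ J : Finset Y, ∀ x, z x ≠ 0 → S.OrbitBounded J x :=
  hz.1.orbitBounded fun x hx w => by
    rw [Set.mem_ofPred_eq, ← hz.2]
    exact hx

theorem mem_boundedHecke_of_invariant {z : Y → R} (hz : z ∈ S.looijengaInvariants R) :
    S.ofLooijenga z ∈ S.boundedHecke R := by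
  obtain ⟨J, hJ⟩ := exists_orbitBounded_of_invariant hz
  refine ⟨⟨fun x w h => (hJ x (ofLooijenga_ne_zero h)).mem_Yplus, ?_, fun w => ?_⟩, J,
    fun x w h => hJ x (ofLooijenga_ne_zero h)⟩
  · exact (Set.finite_singleton 1).subset fun w ⟨x, h⟩ => snd_eq_one_of_ofLooijenga_ne_zero h
  · exact hz.1.mono fun x h => ofLooijenga_ne_zero (p := (x, w)) h

theorem convDefined_ofLooijenga {z : Y → R} (hz : z ∈ S.looijenga R) {a : Y × S.W → R}
    (ha : a ∈ S.completedHecke R) : P.ConvDefined (S.ofLooijenga z) a := by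
  intro q
  refine ((AlmostFinite.finite_sub hz (ha.2.2 q.2) q.1).image
    fun x => (((x, 1), (q.1 - x, q.2)) : (Y × S.W) × (Y × S.W))).subset fun p hp => ?_
  obtain ⟨h1, h2, h3⟩ := convTerm_ofLooijenga_ne_zero P hp
  exact ⟨p.1.1, ⟨h2, h3⟩, h1.symm⟩

/-- Invariant series commute with the elements of the completed Hecke algebra. -/
theorem conv_ofLooijenga_comm [Module.Free ℤ Y] {z : Y → R} (hz : z ∈ S.looijengaInvariants R)
    {a : Y × S.W → R} (ha : a ∈ S.completedHecke R) :
    P.ConvDefined (S.ofLooijenga z) a ∧ P.ConvDefined a (S.ofLooijenga z) ∧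
      P.conv (S.ofLooijenga z) a = P.conv a (S.ofLooijenga z) := by
  obtain ⟨J, hJ⟩ := exists_orbitBounded_of_invariant hz
  have d1 := convDefined_ofLooijenga P hz.1 ha
  have d2 : P.ConvDefined a (S.ofLooijenga z) :=
    convDefined_of_orbitBounded P ha fun p hp => hJ _ (ofLooijenga_ne_zero hp)
  refine ⟨d1, d2, funext fun q => ?_⟩
  have hinj : Function.Injective fun x : Y => ((x, 1) : Y × S.W) :=
    fun x y h => congrArg Prod.fst h
  -- Both convolutions are grouped by the terms of `a`; the inner sums over `x` then agree by
  -- `finsum_leftWord`.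
  have e2 : P.conv a (S.ofLooijenga z) q =
      ∑ᶠ p : Y × S.W, a p * ∑ᶠ x, z x *
        leftWord P (S.reducedWord p.2) (S.ZH R x 1) (q.1 - p.1, q.2) := by
    rw [Parameters.conv, finsum_curry _ (d2 q)]
    refine finsum_congr fun p => ?_
    rw [finsum_eq_finsum_comp hinj]
    · rw [mul_finsum']
      · refine finsum_congr fun x => ?_
        rw [convTerm, ofLooijenga_apply_one, blMul_ZH_apply, mul_assoc]
      · refine ((finite_preimage_leftWord P J (S.reducedWord p.2) (q.1 - p.1, q.2)).preimage
          hinj.injOn).subset fun x hx => ?_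
        exact ⟨hJ x (left_ne_zero_of_mul hx), right_ne_zero_of_mul hx⟩
    · rintro ⟨x, w⟩ h
      exact ⟨x, Prod.ext rfl (snd_eq_one_of_ofLooijenga_ne_zero
        (right_ne_zero_of_mul (left_ne_zero_of_mul h))).symm⟩
  have e1 : P.conv (S.ofLooijenga z) a q =
      ∑ᶠ p : Y × S.W, a p * ∑ᶠ x, z x * S.leftZ R x (S.ZH R p.1 p.2) q := by
    rw [Parameters.conv, ← finsum_comp_equiv (Equiv.prodComm _ _), finsum_curry]
    · refine finsum_congr fun p => ?_
      rw [finsum_eq_finsum_comp hinj]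
      · rw [mul_finsum']
        · refine finsum_congr fun x => ?_
          rw [convTerm, Equiv.prodComm_apply, Prod.swap_prod_mk, ofLooijenga_apply_one,
            blMul_ZH_one, mul_comm (z x), mul_assoc]
        · exact (finite_leftZ (S.ZH R p.1 p.2) q).subset fun x hx => right_ne_zero_of_mul hx
      · rintro ⟨x, w⟩ h
        exact ⟨x, Prod.ext rfl (snd_eq_one_of_ofLooijenga_ne_zero
          (left_ne_zero_of_mul (left_ne_zero_of_mul h))).symm⟩
    · exact (d1 q).preimage (Equiv.prodComm _ _).injective.injOn
  rw [e1, e2]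
  refine finsum_congr fun p => congrArg (a p * ·) ?_
  rw [finsum_leftWord P (fun i x => (hz.2 x (S.s i)).symm) hJ, leftWord_reducedWord]
  refine finsum_congr fun x => congrArg (z x * ·) ?_
  have h1 : S.ZH R p.1 p.2 = S.leftZ R p.1 (S.ZH R 0 p.2) := by rw [leftZ_ZH, add_zero]
  rw [h1, leftZ_apply, leftZ_apply, leftZ_apply, sub_right_comm]

/-- An element of `Ĥ` that commutes with the `Z^x`, `x ∈ Y⁺`, and with the `H_w` is an invariant
series. -/
theorem mem_invariants_of_commute [Module.Free ℤ Y] [Module.Finite ℤ Y] {z : Y × S.W → R}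
    (hz : z ∈ S.completedHecke R)
    (hZ : ∀ x ∈ S.Yplus, P.conv z (S.ZH R x 1) = P.conv (S.ZH R x 1) z)
    (hH : ∀ w : S.W, P.conv z (S.ZH R 0 w) = P.conv (S.ZH R 0 w) z) :
    ∃ c ∈ S.looijengaInvariants R, S.ofLooijenga c = z := by
  have hone : ∀ p, z p ≠ 0 → p.2 = 1 := by
    intro p hp
    obtain ⟨w, ⟨x, hx⟩, hmax⟩ := hz.2.1.exists_maximalFor S.length _ ⟨p.2, p.1, hp⟩
    have hmax : ∀ p, z p ≠ 0 → S.length p.2 ≤ S.length w := by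
      intro p hp
      rcases le_total (S.length p.2) (S.length w) with h | h
      · exact h
      · exact hmax ⟨p.1, hp⟩ h
    have hw : w = 1 := by
      refine eq_one_of_forall_Yplus fun y hy => ?_
      -- Compare the coefficients of `Z^{u+y} H_w` in `z * Z^y` and `Z^y * z`. The resulting
      -- periodicity puts a whole line into an almost finite set unless `w` fixes `y`.
      have h1 : ∀ u, z (u + (y - (w : Y ≃ₗ[ℤ] Y) y), w) = z (u, w) := by
        intro u
        have h2 := congrFun (hZ y hy) (u + y, w)
        rw [conv_Z_left, conv_Z_right_of_maximal P z _ _ _ hmax] at h2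
        simpa [add_sub_assoc] using h2
      obtain ⟨m, hm⟩ := sub_mem_range_corootComb y w
      have h2 : y - (w : Y ≃ₗ[ℤ] Y) y = S.corootComb (-m) := by rw [map_neg, ← hm]; abel
      rw [h2] at h1
      have h3 : ∀ n : ℤ, z (x + n • S.corootComb (-m), w) ≠ 0 := by
        intro n
        induction n using Int.induction_on with
        | zero => simpa using hx
        | succ n ih =>
          rw [add_smul, one_smul, ← add_assoc, h1]
          exact ih
        | pred n ih =>
          rw [sub_smul, one_smul]
          rw [← h1]
          convert ih using 3
          module
      have h4 := AlmostFinite.eq_zero_of_line (hz.2.2 w) h3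
      rw [h4, map_zero, sub_eq_zero] at h2
      exact h2.symm
    have h5 := hmax p hp
    rw [hw, length_one] at h5
    exact eq_one_of_length_eq_zero (Nat.le_zero.1 h5)
  refine ⟨fun x => z (x, 1), ⟨hz.2.2 1, fun x w => ?_⟩, ?_⟩
  -- Conjugation by `H_w` would produce `w⁻¹(x)`, so `w⁻¹` is used to obtain `w(x)`.
  · have h1 := congrFun (hH w⁻¹) (x, w⁻¹)
    rw [conv_H_right_of_eq_one P z _ _ hone, conv_H_left_of_eq_one P z _ _ hone, inv_inv] at h1
    exact h1
  · funext p
    obtain ⟨x, w⟩ := p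
    by_cases hw : w = 1
    · rw [hw, ofLooijenga_apply_one]
    · rw [ofLooijenga, if_neg hw]
      by_contra hne
      exact hw (hone _ (Ne.symm hne))

theorem ZH_mem_boundedHecke {x : Y} (hx : x ∈ S.Yplus) (w : S.W) :
    ⇑(S.ZH R x w) ∈ S.boundedHecke R := by
  obtain ⟨y, hy⟩ := exists_orbitBounded hx
  refine ⟨⟨fun x' w' h => ?_, ?_, fun w' => ?_⟩, {y}, fun x' w' h => ?_⟩
  · obtain ⟨rfl, rfl⟩ := Prod.mk.injEq _ _ _ _ ▸ eq_of_ZH_apply_ne_zero h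
    exact hx
  · exact (Set.finite_singleton w).subset fun w' ⟨x', h⟩ =>
      congrArg Prod.snd (eq_of_ZH_apply_ne_zero h)
  · exact AlmostFinite.of_finite ((Set.finite_singleton x).subset fun x' h =>
      congrArg Prod.fst (eq_of_ZH_apply_ne_zero h))
  · obtain ⟨rfl, rfl⟩ := Prod.mk.injEq _ _ _ _ ▸ eq_of_ZH_apply_ne_zero h
    exact hy

/-- The center of a set of formal sums between the bounded Hecke algebra and `Ĥ`. -/
theorem convCenter_eq [Module.Free ℤ Y] [Module.Finite ℤ Y] {V : Set (Y × S.W → R)}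
    (hV : V ⊆ S.completedHecke R) (hV' : S.boundedHecke R ⊆ V) :
    P.convCenter V = S.ofLooijenga '' S.looijengaInvariants R := by
  ext z
  constructor
  · rintro ⟨hz, h⟩
    exact mem_invariants_of_commute P (hV hz)
      (fun x hx => (h _ (hV' (ZH_mem_boundedHecke hx 1))).2.2)
      (fun w => (h _ (hV' (ZH_mem_boundedHecke zero_mem_Yplus w))).2.2)
  · rintro ⟨c, hc, rfl⟩
    exact ⟨hV' (mem_boundedHecke_of_invariant hc), fun a ha => conv_ofLooijenga_comm P hc (hV ha)⟩

/-- A lattice part in the product is that of a term of `a` plus one reached along coroot strings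
from a term of `b`, so the orbit bounds add. Membership in `Y⁺` follows from the bound. -/
theorem conv_mem_boundedHecke {a b : Y × S.W → R} (ha : a ∈ S.boundedHecke R)
    (hb : b ∈ S.boundedHecke R) : P.conv a b ∈ S.boundedHecke R := by
  classical
  obtain ⟨⟨_, hfa, _⟩, J, hJ⟩ := ha
  obtain ⟨⟨_, hfb, _⟩, J', hJ'⟩ := hb
  have hterm : ∀ q, P.conv a b q ≠ 0 → ∃ p : (Y × S.W) × (Y × S.W), a p.1 ≠ 0 ∧ b p.2 ≠ 0 ∧
      leftWord P (S.reducedWord p.1.2) (S.ZH R p.2.1 p.2.2) (q.1 - p.1.1, q.2) ≠ 0 := by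
    intro q hq
    obtain ⟨p, hp⟩ : ∃ p, convTerm P a b q p ≠ 0 := by
      by_contra! hcon
      exact hq (by rw [Parameters.conv, finsum_congr hcon, finsum_zero])
    rw [convTerm, blMul_ZH_apply] at hp
    exact ⟨p, left_ne_zero_of_mul (left_ne_zero_of_mul hp),
      right_ne_zero_of_mul (left_ne_zero_of_mul hp), right_ne_zero_of_mul hp⟩
  have hbd : ∀ x w, P.conv a b (x, w) ≠ 0 →
      S.OrbitBounded (Finset.image₂ (· + ·) J J') x := by
    intro x w h
    obtain ⟨p, h1, h2, h3⟩ := hterm _ h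
    have h4 : S.OrbitBounded J p.1.1 := hJ _ _ h1
    have h5 : S.OrbitBounded J' p.2.1 := hJ' _ _ h2
    simpa using h4.add (h5.leftWord P h3)
  refine ⟨⟨fun x w h => (hbd x w h).mem_Yplus, ?_, fun w => ?_⟩, _, hbd⟩
  · choose F hF hF' using fun v w => finite_range_leftWord P (S.reducedWord v) w
    refine (hfa.biUnion fun v _ => hfb.biUnion fun w _ => hF v w).subset ?_
    rintro u ⟨x, h⟩
    obtain ⟨p, h1, h2, h3⟩ := hterm _ h
    exact Set.mem_biUnion ⟨_, h1⟩ (Set.mem_biUnion ⟨_, h2⟩ (hF' _ _ _ _ h3))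
  · exact (OrbitBounded.almostFinite S _).mono fun x h => hbd x w h

theorem looijengaMul_mem_invariants {a b : Y → R} (ha : a ∈ S.looijengaInvariants R)
    (hb : b ∈ S.looijengaInvariants R) : looijengaMul a b ∈ S.looijengaInvariants R := by
  classical
  constructor
  · obtain ⟨J, hJ⟩ := ha.1
    obtain ⟨J', hJ'⟩ := hb.1
    refine ⟨Finset.image₂ (· + ·) J J', fun z hz => ?_⟩
    obtain ⟨x, hx⟩ : ∃ x, a x * b (z - x) ≠ 0 := by
      by_contra! hcon
      exact hz (by rw [looijengaMul, finsum_congr hcon, finsum_zero])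
    obtain ⟨y, hy, h⟩ := hJ x (left_ne_zero_of_mul hx)
    obtain ⟨y', hy', h'⟩ := hJ' _ (right_ne_zero_of_mul hx)
    refine ⟨y + y', Finset.mem_image₂_of_mem hy hy', ?_⟩
    simpa using leQ_add h h'
  · intro z w
    rw [looijengaMul, looijengaMul, ← finsum_comp_equiv (w : Y ≃ₗ[ℤ] Y).toEquiv
      (f := fun x => a x * b ((w : Y ≃ₗ[ℤ] Y) z - x))]
    refine finsum_congr fun x => ?_
    have h1 := hb.2 (z - x) w
    rw [map_sub] at h1
    rw [ha.2 x w, h1]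
    rfl

end Center

/-! ### The center of the Iwahori-Hecke algebra. -/

section Hecke

variable {I Y R : Type*} [AddCommGroup Y] [CommRing R]
  {S : RootGeneratingSystem I Y} (P : S.Parameters R)

theorem mem_hecke_iff {a : S.BL R} : a ∈ S.hecke R ↔ ∀ p, a p ≠ 0 → p.1 ∈ S.Yplus := by
  have h : {a | ∃ x ∈ S.Yplus, ∃ w : S.W, a = S.ZH R x w} =
      (fun p : Y × S.W => Finsupp.single p (1 : R)) '' {p | p.1 ∈ S.Yplus} := by
    ext a
    constructor
    · rintro ⟨x, hx, w, rfl⟩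
      exact ⟨(x, w), hx, rfl⟩
    · rintro ⟨p, hp, rfl⟩
      exact ⟨p.1, hp, p.2, rfl⟩
  rw [hecke, h, ← Finsupp.supported_eq_span_single, Finsupp.mem_supported]
  simp [Set.subset_def]

theorem conv_coe (a b : S.BL R) : P.conv a b = blMul P a b := by
  funext q
  have h1 : blMul P a b q =
      ∑ p ∈ a.support, ∑ p' ∈ b.support, convTerm P a b q (p, p') := by
    have h2 := apply_eq_sum ((blMul P).flip b) a q
    rw [LinearMap.flip_apply] at h2
    rw [h2, Finsupp.sum]
    refine Finset.sum_congr rfl fun p _ => ?_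
    rw [LinearMap.flip_apply, apply_eq_sum, Finsupp.sum, Finset.mul_sum]
    exact Finset.sum_congr rfl fun p' _ => (mul_assoc _ _ _).symm
  rw [h1, ← Finset.sum_product', Parameters.conv]
  refine finsum_eq_sum_of_support_subset _ fun p hp => ?_
  rw [Finset.mem_coe, Finset.mem_product, Finsupp.mem_support_iff, Finsupp.mem_support_iff]
  exact ⟨left_ne_zero_of_mul (left_ne_zero_of_mul hp),
    right_ne_zero_of_mul (left_ne_zero_of_mul hp)⟩

theorem coe_sum_ZH (c : Y →₀ R) : ⇑(c.sum fun x r => r • S.ZH R x 1) = S.ofLooijenga c := by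
  classical
  funext q
  obtain ⟨y, w⟩ := q
  rw [Finsupp.sum, Finsupp.finsetSum_apply]
  simp only [Finsupp.smul_apply, smul_eq_mul]
  by_cases hw : w = 1
  · rw [hw, ofLooijenga_apply_one, Finset.sum_eq_single y]
    · rw [ZH_apply, if_pos rfl, mul_one]
    · intro x _ hx
      rw [ZH_apply, if_neg (fun h => hx (congrArg Prod.fst h)), mul_zero]
    · intro hy
      rw [Finsupp.notMem_support_iff.1 hy, zero_mul]
  · rw [ofLooijenga, if_neg hw]
    refine Finset.sum_eq_zero fun x _ => ?_
    rw [ZH_apply, if_neg (fun h => hw (congrArg Prod.snd h).symm), mul_zero]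

variable [Fintype I]

theorem coe_mem_completedHecke {a : S.BL R} (ha : a ∈ S.hecke R) :
    ⇑a ∈ S.completedHecke R := by
  refine ⟨fun x w h => mem_hecke_iff.1 ha (x, w) h, ?_, fun w => AlmostFinite.of_finite ?_⟩
  · exact (a.support.finite_toSet.image Prod.snd).subset fun w ⟨x, h⟩ =>
      ⟨(x, w), Finsupp.mem_support_iff.2 h, rfl⟩
  · exact (a.support.finite_toSet.image Prod.fst).subset fun x h =>
      ⟨(x, w), Finsupp.mem_support_iff.2 h, rfl⟩

/-- The center of the Iwahori-Hecke algebra is the invariant part of the group algebra of any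
subgroup of `Y` that contains all finite orbits. -/
theorem heckeCenter_eq [Module.Free ℤ Y] [Module.Finite ℤ Y] {L : Submodule ℤ Y}
    (hL : ∀ x, {y | ∃ w : S.W, (w : Y ≃ₗ[ℤ] Y) x = y}.Finite → x ∈ L) :
    P.heckeCenter = S.groupAlgInvariants R L := by
  ext z
  constructor
  · rintro ⟨hz, h⟩
    have hmem : ∀ x ∈ S.Yplus, ∀ w, S.ZH R x w ∈ S.hecke R := fun x hx w =>
      Submodule.subset_span ⟨x, hx, w, rfl⟩
    obtain ⟨c, hc, e⟩ := mem_invariants_of_commute P (coe_mem_completedHecke hz)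
      (fun x hx => by rw [conv_coe, conv_coe, h _ (hmem x hx 1)])
      (fun w => by rw [conv_coe, conv_coe, h _ (hmem 0 zero_mem_Yplus w)])
    have hfin : (Function.support c).Finite := by
      refine (z.support.finite_toSet.image Prod.fst).subset fun x hx => ?_
      refine ⟨(x, 1), Finsupp.mem_support_iff.2 ?_, rfl⟩
      rw [← e, ofLooijenga_apply_one]
      exact hx
    -- The support of `c` is finite and stable under `W^v`, so it contains only finite orbits.
    refine ⟨Finsupp.ofSupportFinite c hfin, fun x hx => hL x (hfin.subset ?_),
      fun w x => (hc.2 x w).symm, ?_⟩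
    · rintro _ ⟨w, rfl⟩
      rw [Function.mem_support, ← hc.2]
      exact hx
    · apply DFunLike.coe_injective
      rw [coe_sum_ZH, ← e]
      rfl
  · rintro ⟨c, _, hc, rfl⟩
    have hinv : ⇑c ∈ S.looijengaInvariants R :=
      ⟨AlmostFinite.of_finite (c.support.finite_toSet.subset fun x hx =>
        Finsupp.mem_support_iff.2 hx), fun x w => (hc w x).symm⟩
    refine ⟨mem_hecke_iff.2 fun p hp => ?_, fun a ha => ?_⟩
    · rw [coe_sum_ZH] at hp
      exact (mem_boundedHecke_of_invariant hinv).1.1 p.1 p.2 hp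
    · apply DFunLike.coe_injective
      rw [← conv_coe, ← conv_coe, coe_sum_ZH]
      exact (conv_ofLooijenga_comm P hinv (coe_mem_completedHecke ha)).2.2

end Hecke

/-! ### A criterion for finite type. -/

section CartanMatrix

variable {ι : Type*}

/-- A matrix with non-positive off-diagonal entries and a connected graph. -/
structure IsIndecomposable (B : Matrix ι ι ℝ) : Prop where
  offdiag : ∀ i j, i ≠ j → B i j ≤ 0
  zero : ∀ i j, B i j = 0 → B j i = 0
  connected : ∀ p : ι → Prop, (∀ i j, B i j ≠ 0 → p i → p j) → ∀ i j, p i → p j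

variable {B : Matrix ι ι ℝ}

theorem IsIndecomposable.transpose (hB : IsIndecomposable B) : IsIndecomposable B.transpose where
  offdiag i j h := hB.offdiag j i h.symm
  zero i j := hB.zero j i
  connected p hp := hB.connected p fun i j h => hp i j fun h' => h (hB.zero j i h')

theorem IsIndecomposable.mul_nonpos (hB : IsIndecomposable B) {w : ι → ℝ} (hw : ∀ i, 0 ≤ w i)
    {k : ι} (hk : w k = 0) (j : ι) : B k j * w j ≤ 0 := by
  by_cases h : k = j
  · rw [← h, hk, mul_zero]
  · exact mul_nonpos_of_nonpos_of_nonneg (hB.offdiag k j h) (hw j)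

variable [Fintype ι]

theorem IsIndecomposable.mulVec_nonpos (hB : IsIndecomposable B) {w : ι → ℝ}
    (hw : ∀ i, 0 ≤ w i) {k : ι} (hk : w k = 0) : B.mulVec w k ≤ 0 :=
  Finset.sum_nonpos fun j _ => hB.mul_nonpos hw hk j

/-- At a zero of `w` all terms of `(B w) i` are nonpositive while their sum is nonnegative. Hence
`w` vanishes at all neighbours, and connectedness spreads the zero. -/
theorem IsIndecomposable.eq_zero (hB : IsIndecomposable B) {w : ι → ℝ} (hw : ∀ i, 0 ≤ w i)
    (hBw : ∀ i, 0 ≤ B.mulVec w i) {k : ι} (hk : w k = 0) : w = 0 := by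
  funext i
  refine hB.connected (fun i => w i = 0) (fun i j hij hi => ?_) k i hk
  have h0 : ∑ j, B i j * w j = 0 := le_antisymm (hB.mulVec_nonpos hw hi) (hBw i)
  have h1 := (Finset.sum_eq_zero_iff_of_nonpos fun j _ => hB.mul_nonpos hw hi j).1 h0 j
    (Finset.mem_univ j)
  exact (mul_eq_zero.1 h1).resolve_left hij

theorem IsIndecomposable.pos_or_eq_zero (hB : IsIndecomposable B) {w : ι → ℝ}
    (hw : ∀ i, 0 ≤ w i) (hBw : ∀ i, 0 ≤ B.mulVec w i) : (∀ i, 0 < w i) ∨ w = 0 := by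
  by_cases h : ∃ k, w k = 0
  · obtain ⟨k, hk⟩ := h
    exact Or.inr (hB.eq_zero hw hBw hk)
  · push Not at h
    exact Or.inl fun i => lt_of_le_of_ne (hw i) (h i).symm

/-- A matrix is of finite type if its transpose has a non-negative vector with non-negative and
non-zero image. -/
theorem IsIndecomposable.finite_type [DecidableEq ι] (hB : IsIndecomposable B) {v : ι → ℝ}
    (hv : ∀ i, 0 ≤ v i) (hBv : ∀ i, 0 ≤ B.transpose.mulVec v i) {k : ι}
    (hk : 0 < B.transpose.mulVec v k) :
    B.det ≠ 0 ∧ (∃ u : ι → ℝ, (∀ i, 0 < u i) ∧ ∀ i, 0 < B.mulVec u i) ∧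
      ∀ w : ι → ℝ, (∀ i, 0 ≤ B.mulVec w i) → (∀ i, 0 < w i) ∨ w = 0 := by
  have hv0 : ∀ i, 0 < v i := by
    refine (hB.transpose.pos_or_eq_zero hv hBv).resolve_right fun h => ?_
    rw [h, Matrix.mulVec_zero] at hk
    exact lt_irrefl _ hk
  have key : ∀ w : ι → ℝ, (∀ i, 0 ≤ B.mulVec w i) → (∀ i, 0 < w i) ∨ w = 0 := by
    intro w hw
    refine hB.pos_or_eq_zero (fun i => ?_) hw
    -- For the negative part `n` of `w`, one has `B n ≤ 0`: where `n` vanishes by the sign of the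
    -- off-diagonal entries, elsewhere because `B n = B w⁺ - B w`.
    set n : ι → ℝ := fun i => max (-w i) 0 with hn
    have hn0 : ∀ i, 0 ≤ n i := fun i => le_max_right _ _
    have hBn : ∀ i, B.mulVec n i ≤ 0 := by
      intro i
      rcases le_total 0 (w i) with h | h
      · exact hB.mulVec_nonpos hn0 (max_eq_right (by linarith))
      · have e : n = (fun i => max (w i) 0) - w := by
          funext j
          simp only [hn, Pi.sub_apply]
          rcases le_total 0 (w j) with h | h
          · rw [max_eq_right (by linarith), max_eq_left h, sub_self]
          · rw [max_eq_left (by linarith), max_eq_right h, zero_sub]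
        rw [e, Matrix.mulVec_sub, Pi.sub_apply]
        have h1 := hB.mulVec_nonpos (w := fun i => max (w i) 0) (fun i => le_max_right _ _)
          (k := i) (max_eq_right h)
        have h2 := hw i
        linarith
    -- Pairing with `v` gives `0 ≥ v · B n = Bᵀ v · n ≥ 0`. Since `v > 0`, this yields `B n = 0`;
    -- since `(Bᵀ v) k > 0`, it yields `n k = 0`, and then `n = 0`.
    have hsum : ∑ i, v i * B.mulVec n i = ∑ i, B.transpose.mulVec v i * n i := by
      have h1 := Matrix.dotProduct_mulVec v B n
      rw [← Matrix.mulVec_transpose] at h1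
      exact h1
    have h1 : ∑ i, v i * B.mulVec n i ≤ 0 :=
      Finset.sum_nonpos fun i _ => mul_nonpos_of_nonneg_of_nonpos (hv i) (hBn i)
    have h2 : 0 ≤ ∑ i, B.transpose.mulVec v i * n i :=
      Finset.sum_nonneg fun i _ => mul_nonneg (hBv i) (hn0 i)
    have h3 : ∀ i, B.mulVec n i = 0 := fun i => by
      have h4 := (Finset.sum_eq_zero_iff_of_nonpos fun i _ =>
        mul_nonpos_of_nonneg_of_nonpos (hv i) (hBn i)).1 (le_antisymm h1 (hsum ▸ h2)) i
          (Finset.mem_univ i)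
      exact (mul_eq_zero.1 h4).resolve_left (hv0 i).ne'
    have h5 : n k = 0 := by
      have h4 := (Finset.sum_eq_zero_iff_of_nonneg fun i _ =>
        mul_nonneg (hBv i) (hn0 i)).1 (le_antisymm (hsum ▸ h1) h2) k (Finset.mem_univ k)
      exact (mul_eq_zero.1 h4).resolve_left hk.ne'
    have h6 := congrFun (hB.eq_zero hn0 (fun i => (h3 i).ge) h5) i
    have h7 : -w i ≤ n i := le_max_left _ _
    rw [h6, Pi.zero_apply] at h7
    linarith
  have hdet : B.det ≠ 0 := by
    intro h
    obtain ⟨w, hw, h0⟩ := Matrix.exists_mulVec_eq_zero_iff.2 h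
    have h1 := (key w fun i => by rw [h0, Pi.zero_apply]).resolve_right hw k
    have h2 := (key (-w) fun i => by
      rw [Matrix.mulVec_neg, h0, neg_zero, Pi.zero_apply]).resolve_right (neg_ne_zero.2 hw) k
    rw [Pi.neg_apply] at h2
    linarith
  refine ⟨hdet, ⟨B⁻¹.mulVec 1, ?_⟩, key⟩
  have h1 : B.mulVec (B⁻¹.mulVec 1) = 1 := by
    rw [Matrix.mulVec_mulVec, Matrix.mul_nonsing_inv _ (isUnit_iff_ne_zero.2 hdet),
      Matrix.one_mulVec]
  rw [h1]
  refine ⟨(key _ fun i => by rw [h1]; exact zero_le_one).resolve_right fun h => ?_,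
    fun i => zero_lt_one⟩
  rw [h, Matrix.mulVec_zero] at h1
  exact zero_ne_one (congrFun h1 k)

end CartanMatrix

/-! ### Finite orbits and components of finite type. -/

section FiniteOrbits

variable {I Y : Type*} [AddCommGroup Y] {S : RootGeneratingSystem I Y}

theorem component_eq_of_A_ne_zero {i j : I} (h : S.A i j ≠ 0) :
    S.graph.connectedComponentMk i = S.graph.connectedComponentMk j := by
  by_cases hij : i = j
  · rw [hij]
  · exact SimpleGraph.ConnectedComponent.eq.2 (SimpleGraph.Adj.reachable (G := S.graph) ⟨hij, h⟩)

theorem isIndecomposable_compMatrix (c : S.Component) : IsIndecomposable (S.compMatrix c) where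
  offdiag i j h := by
    rw [compMatrix, Matrix.of_apply]
    exact_mod_cast S.A_offdiag i j fun e => h (Subtype.ext e)
  zero i j h := by
    rw [compMatrix, Matrix.of_apply, Int.cast_eq_zero] at h ⊢
    exact (S.A_zero _ _).1 h
  connected p hp i j hi := by
    have h1 : S.graph.Reachable i j := SimpleGraph.ConnectedComponent.eq.1 (i.2.trans j.2.symm)
    rw [SimpleGraph.reachable_iff_reflTransGen] at h1
    obtain ⟨j, hj⟩ := j
    dsimp only at h1
    suffices ∀ h : S.graph.connectedComponentMk j = c, p ⟨j, h⟩ from this hj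
    clear hj
    induction h1 with
    | refl => exact fun _ => hi
    | tail h1 h2 ih =>
      intro h
      have h3 := (component_eq_of_A_ne_zero h2.2).trans h
      refine hp ⟨_, h3⟩ ⟨_, h⟩ ?_ (ih h3)
      rw [compMatrix, Matrix.of_apply, Int.cast_ne_zero]
      exact h2.2

/-- The simple roots of a component that vanish at `x` vanish on its orbit. -/
theorem root_orbit_eq_zero {c : S.Component} {x : Y}
    (h : ∀ i, S.graph.connectedComponentMk i = c → S.root i x = 0) (w : S.W) :
    ∀ i, S.graph.connectedComponentMk i = c → S.root i ((w : Y ≃ₗ[ℤ] Y) x) = 0 := by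
  refine orbit_induction
    (p := fun y => ∀ i, S.graph.connectedComponentMk i = c → S.root i y = 0) h ?_ w
  intro j y hy i hi
  rw [root_refl, hy i hi]
  by_cases hA : S.A j i = 0
  · rw [hA, mul_zero, sub_zero]
  · rw [hy j ((component_eq_of_A_ne_zero hA).trans hi), zero_mul, sub_zero]

variable [Fintype I]

/-- If the orbit of a dominant `x` is finite and a simple root of a component does not vanish
at `x`, then the component is of finite type. -/
theorem isFiniteType_of_dominant {x : Y} (hx : ∀ i, 0 ≤ S.root i x)
    (hfin : {y | ∃ w : S.W, (w : Y ≃ₗ[ℤ] Y) x = y}.Finite) {k : I} (hk : S.root k x ≠ 0) :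
    S.IsFiniteType (S.graph.connectedComponentMk k) := by
  classical
  -- Write `w(-x) = -x + ∑ m i α_i^∨` with `m ≥ 0` and `w(-x)` dominant. Applying `α_j` gives `∑ m i
  -- A i j ≥ α_j(x) ≥ 0`, strictly positive for `j = k`: the vector required by
  -- `IsIndecomposable.finite_type`.
  obtain ⟨w, hle, hw⟩ := exists_dominant_of_finite (S := S) (x := -x)
    ((hfin.image Neg.neg).subset (by
      rintro _ ⟨_, w, rfl⟩
      exact ⟨_, ⟨w, rfl⟩, by rw [map_neg]⟩))
  obtain ⟨m, hm, e⟩ := leQ_iff.1 hle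
  have hroot : ∀ j, S.root j x ≤ ∑ i, m i * S.A i j := by
    intro j
    have h1 := congrArg (S.root j) e
    rw [corootComb_apply, map_sum, map_sub, map_neg (S.root j) x] at h1
    simp only [map_smul, root_coroot, smul_eq_mul] at h1
    have h2 := hw j
    linarith
  set c := S.graph.connectedComponentMk k with hc
  let v : S.compIndex c → ℝ := fun i => (m i : ℝ)
  have hv : ∀ j : S.compIndex c,
      (S.compMatrix c).transpose.mulVec v j = ((∑ i, m i * S.A i j : ℤ) : ℝ) := by
    intro j
    have h1 : ∑ i, m i * S.A i j =
        ∑ i ∈ Finset.univ.filter fun i => S.graph.connectedComponentMk i = c, m i * S.A i j :=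
      (Finset.sum_filter_of_ne fun i _ h =>
        (component_eq_of_A_ne_zero (right_ne_zero_of_mul h)).trans j.2).symm
    rw [h1, Finset.sum_subtype (p := fun i => S.graph.connectedComponentMk i = c) _ (by simp),
      Int.cast_sum, Matrix.mulVec, dotProduct]
    refine Finset.sum_congr rfl fun i _ => ?_
    rw [Int.cast_mul, mul_comm]
    rfl
  exact (isIndecomposable_compMatrix c).finite_type (v := v) (k := ⟨k, rfl⟩)
    (fun i => Int.cast_nonneg (hm i))
    (fun j => by rw [hv]; exact Int.cast_nonneg ((hx j).trans (hroot j)))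
    (by
      rw [hv, Int.cast_pos]
      exact lt_of_lt_of_le (lt_of_le_of_ne (hx k) hk.symm) (hroot k))

/-- The roots of a component not of finite type vanish at the dominant representative, and this
vanishing passes to the whole orbit. -/
theorem mem_latticeFin_of_finite_orbit {x : Y}
    (hfin : {y | ∃ w : S.W, (w : Y ≃ₗ[ℤ] Y) x = y}.Finite) : x ∈ S.latticeFin := by
  obtain ⟨w, _, hw⟩ := exists_dominant_of_finite (S := S) (x := x)
    (hfin.subset fun y hy => hy.2)
  have hfin' : {y | ∃ v : S.W, (v : Y ≃ₗ[ℤ] Y) ((w : Y ≃ₗ[ℤ] Y) x) = y}.Finite :=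
    hfin.subset fun y ⟨v, hv⟩ => ⟨v * w, hv⟩
  simp only [latticeFin, Submodule.mem_iInf, LinearMap.mem_ker]
  intro i hi
  have h1 : ∀ j, S.graph.connectedComponentMk j = S.graph.connectedComponentMk i →
      S.root j ((w : Y ≃ₗ[ℤ] Y) x) = 0 := by
    intro j hj
    by_contra hne
    exact hi (hj ▸ isFiniteType_of_dominant hw hfin' hne)
  have h2 := root_orbit_eq_zero h1 w⁻¹ i rfl
  rwa [coe_inv_apply_apply] at h2

end FiniteOrbits

/-! ### Decompositions of the apartment. -/

section Decomposition

variable {I Y : Type*} [AddCommGroup Y] {S : RootGeneratingSystem I Y}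

theorem realRoot_tmul (i : I) (x : Y) : S.realRoot i ((1 : ℝ) ⊗ₜ[ℤ] x) = S.root i x := by
  rw [realRoot, Module.Dual.baseChange_apply_tmul]
  simp

theorem mem_latticeInter {V : Submodule ℝ (Apartment Y)} {x : Y} :
    x ∈ latticeInter V ↔ (1 : ℝ) ⊗ₜ[ℤ] x ∈ V := Iff.rfl

theorem ApartmentDecomposition.mem_spaceIn_iff (D : S.ApartmentDecomposition) {c : S.Component}
    {v : Apartment Y} :
    v ∈ D.spaceIn c ↔ v ∈ D.space c ∧
      ∀ i, S.graph.connectedComponentMk i = c → S.realRoot i v = 0 := by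
  simp [ApartmentDecomposition.spaceIn, Submodule.mem_iInf]

variable [Fintype I] (D : S.ApartmentDecomposition)

theorem ApartmentDecomposition.disjoint : Disjoint D.finPart D.infInPart := by
  classical
  have h : Disjoint (⨆ c ∈ {c | S.IsFiniteType c}, D.space c)
      (⨆ c ∈ {c | ¬ S.IsFiniteType c}, D.space c) :=
    D.internal.submodule_iSupIndep.disjoint_biSup_biSup
      (Set.disjoint_left.2 fun c h1 h2 => h2 h1)
  refine h.mono le_rfl ?_
  exact iSup₂_mono fun c _ => inf_le_left

/-- A component of an element killed by the roots of the components of infinite type lies in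
one of the two parts. -/
theorem ApartmentDecomposition.mem_finPart_or_mem_infInPart {f : S.Component →₀ Apartment Y}
    (hf : ∀ c, f c ∈ D.space c)
    (h0 : ∀ i, ¬ S.IsFiniteType (S.graph.connectedComponentMk i) →
      S.realRoot i (f.sum fun _ v => v) = 0) (c : S.Component) :
    f c ∈ D.finPart ∨ f c ∈ D.infInPart := by
  by_cases hc : S.IsFiniteType c
  · exact Or.inl (Submodule.mem_iSup_of_mem c (Submodule.mem_iSup_of_mem hc (hf c)))
  · refine Or.inr (Submodule.mem_iSup_of_mem c (Submodule.mem_iSup_of_mem hc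
      (D.mem_spaceIn_iff.2 ⟨hf c, fun i hi => ?_⟩)))
    subst hi
    -- The root `α_i` kills the summands of all other components, so its value on the sum is its
    -- value on `f c`.
    rw [← h0 i hc, Finsupp.sum, map_sum, eq_comm]
    refine Finset.sum_eq_single _ (fun c _ hne => ?_) (fun h => ?_)
    · exact D.root_eq_zero i c hne.symm _ (hf c)
    · rw [Finsupp.notMem_support_iff.1 h, map_zero]

theorem realRoot_eq_zero_of_mem_latticeFin {x : Y} (hx : x ∈ S.latticeFin) (i : I)
    (hi : ¬ S.IsFiniteType (S.graph.connectedComponentMk i)) :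
    S.realRoot i ((1 : ℝ) ⊗ₜ[ℤ] x) = 0 := by
  simp only [latticeFin, Submodule.mem_iInf, LinearMap.mem_ker] at hx
  rw [realRoot_tmul, hx i hi, Int.cast_zero]

/-- This inclusion suffices for the center, since `heckeCenter_eq` accepts any subgroup containing
the finite orbits. -/
theorem ApartmentDecomposition.latticeFin_le :
    S.latticeFin ≤ latticeInter (D.finPart ⊔ D.infInPart) := by
  classical
  intro x hx
  have hv : (1 : ℝ) ⊗ₜ[ℤ] x ∈ iSup D.space := by
    rw [D.internal.submodule_iSup_eq_top]
    exact Submodule.mem_top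
  obtain ⟨f, hf, e⟩ := (Submodule.mem_iSup_iff_exists_finsupp _ _).1 hv
  rw [mem_latticeInter, ← e]
  refine Submodule.sum_mem _ fun c _ => ?_
  rcases D.mem_finPart_or_mem_infInPart hf
    (fun i hi => e ▸ realRoot_eq_zero_of_mem_latticeFin hx i hi) c with h | h
  · exact Submodule.mem_sup_left h
  · exact Submodule.mem_sup_right h

theorem ApartmentDecomposition.latticeFin_le_of_splits (hD : D.Splits) :
    S.latticeFin ≤ latticeInter D.finPart ⊔ latticeInter D.infInPart := by
  intro x hx
  have hv : x ∈ ⨆ c : S.Component, latticeInter (D.space c) := by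
    rw [hD]
    exact Submodule.mem_top
  obtain ⟨f, hf, rfl⟩ := (Submodule.mem_iSup_iff_exists_finsupp _ _).1 hv
  refine Submodule.sum_mem _ fun c _ => ?_
  let g : S.Component →₀ Apartment Y :=
    f.mapRange (TensorProduct.mk ℤ ℝ Y 1) (map_zero _)
  have hg : (g.sum fun _ v => v) = (1 : ℝ) ⊗ₜ[ℤ] (f.sum fun _ v => v) := by
    rw [Finsupp.sum_mapRange_index fun _ => rfl, Finsupp.sum, Finsupp.sum, TensorProduct.tmul_sum]
    rfl
  rcases D.mem_finPart_or_mem_infInPart (f := g) hf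
    (fun i hi => hg ▸ realRoot_eq_zero_of_mem_latticeFin hx i hi) c with h | h
  · exact Submodule.mem_sup_left h
  · exact Submodule.mem_sup_right h

theorem latticeFin_eq_latticeIn (h : ∀ c : S.Component, ¬ S.IsFiniteType c) :
    S.latticeFin = S.latticeIn := by
  simp [latticeFin, latticeIn, h]

end Decomposition

/-! ### The inessential lattice. -/

section Inessential

variable {I Y : Type*} [AddCommGroup Y] {S : RootGeneratingSystem I Y}

theorem orbit_eq_self_of_mem_latticeIn {x : Y} (hx : x ∈ S.latticeIn) (w : S.W) :
    (w : Y ≃ₗ[ℤ] Y) x = x := by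
  simp only [latticeIn, Submodule.mem_iInf, LinearMap.mem_ker] at hx
  exact orbit_induction (p := fun y => y = x) rfl
    (fun i y hy => by rw [hy]; exact refl_eq_self (hx i)) w

/-- The Weyl group fixes `latticeIn` pointwise, so invariance is automatic. -/
theorem groupAlgInvariants_latticeIn (R : Type*) [CommRing R] :
    S.groupAlgInvariants R S.latticeIn = S.groupAlg R S.latticeIn := by
  ext z
  constructor
  · rintro ⟨c, h, _, e⟩
    exact ⟨c, h, e⟩
  · rintro ⟨c, h, e⟩
    refine ⟨c, h, fun w x => ?_, e⟩
    by_cases hx : x ∈ S.latticeIn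
    · rw [orbit_eq_self_of_mem_latticeIn hx]
    · have h1 : c x = 0 := by
        by_contra hne
        exact hx (h x hne)
      rw [h1]
      by_contra hne
      have h2 := orbit_eq_self_of_mem_latticeIn (h _ hne) w⁻¹
      rw [coe_inv_apply_apply] at h2
      rw [← h2] at hne
      exact hne h1

end Inessential

end RootGeneratingSystem

theorem mainTheorem2 {I Y R : Type*} [Fintype I] [AddCommGroup Y] [Module.Free ℤ Y]
    [Module.Finite ℤ Y] [CommRing R] (S : RootGeneratingSystem I Y) (P : S.Parameters R) :
    -- the center of the completed Iwahori-Hecke algebra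
    P.convCenter (S.completedHecke R) = S.ofLooijenga '' S.looijengaInvariants R ∧
    -- the same for the subset of `Ĥ` on which the convolution is everywhere defined
    ((∀ a ∈ S.boundedHecke R, ∀ b ∈ S.boundedHecke R,
        P.ConvDefined a b ∧ P.conv a b ∈ S.boundedHecke R) ∧
      P.convCenter (S.boundedHecke R) = S.ofLooijenga '' S.looijengaInvariants R) ∧
    -- the identification is compatible with the products
    (∀ a ∈ S.looijengaInvariants R, ∀ b ∈ S.looijengaInvariants R,
      RootGeneratingSystem.looijengaMul a b ∈ S.looijengaInvariants R ∧
      P.conv (S.ofLooijenga a) (S.ofLooijenga b) = S.ofLooijenga (RootGeneratingSystem.looijengaMul a b)) ∧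
    -- the center of the Iwahori-Hecke algebra
    P.heckeCenter = S.groupAlgInvariants R S.latticeFin ∧
    (∀ D : S.ApartmentDecomposition,
      Disjoint D.finPart D.infInPart ∧
      P.heckeCenter = S.groupAlgInvariants R (RootGeneratingSystem.latticeInter (D.finPart ⊔ D.infInPart)) ∧
      (D.Splits → P.heckeCenter =
        S.groupAlgInvariants R (RootGeneratingSystem.latticeInter D.finPart ⊔ RootGeneratingSystem.latticeInter D.infInPart))) ∧
    -- the case without components of finite type
    ((∀ c : S.Component, ¬ S.IsFiniteType c) → P.heckeCenter = S.groupAlg R S.latticeIn) := by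
  -- One criterion yields all descriptions of the center: enlarging `L` beyond `latticeFin` adds no
  -- finitely supported invariants.
  have hle {L : Submodule ℤ Y} (hL : S.latticeFin ≤ L) :
      P.heckeCenter = S.groupAlgInvariants R L :=
    RootGeneratingSystem.heckeCenter_eq P fun _ hx =>
      hL (RootGeneratingSystem.mem_latticeFin_of_finite_orbit hx)
  refine ⟨RootGeneratingSystem.convCenter_eq P le_rfl fun a ha => ha.1,
    ⟨fun a ha b hb => ⟨?_, RootGeneratingSystem.conv_mem_boundedHecke P ha hb⟩,
      RootGeneratingSystem.convCenter_eq P (fun a ha => ha.1) le_rfl⟩,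
    fun a ha b hb => ⟨RootGeneratingSystem.looijengaMul_mem_invariants ha hb,
      RootGeneratingSystem.conv_ofLooijenga_ofLooijenga P a b⟩,
    hle le_rfl, fun D => ⟨D.disjoint, hle D.latticeFin_le,
      fun hD => hle (D.latticeFin_le_of_splits hD)⟩, fun h => ?_⟩
  · obtain ⟨J, hJ⟩ := hb.2
    exact RootGeneratingSystem.convDefined_of_orbitBounded P ha.1 fun p hp => hJ p.1 p.2 hp
  · rw [hle le_rfl, RootGeneratingSystem.latticeFin_eq_latticeIn h,
      RootGeneratingSystem.groupAlgInvariants_latticeIn]
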